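/- A crossed module in groups $(T,G,\mu)$ is a group homomorphism $\mu:T\to G$ together with an action of $G$ on $T$ by automorphisms such that $\mu({}^g t)=g\mu(t)g^{-1}$ and ${}^{\mu(t)}t'=tt't^{-1}$; morphisms are pairs of group homomorphisms compatible with $\mu$ and with the actions. A $\mathrm{cat}^1$-group is a group $G$ with endomorphisms $d_0,d_1$ such that $d_0d_1=d_1$, $d_1d_0=d_0$ and $[\ker d_0,\ker d_1]=1$; morphisms are group homomorphisms commuting with $d_0,d_1$. The functor sending $X=(T,G,\mu)$ to $\mathcal G_X=(T\rtimes G,d_0,d_1)$, $d_0(t,g)=(1,g)$, $d_1(t,g)=(1,\mu(t)g)$, is an equivalence of categories, and through it crossed modules are regarded as a category of interest (with the group operations, $d_0$ and $d_1$ as operations). For a $\mathrm{cat}^1$-group $R$, an $R$-module is a $\mathrm{cat}^1$-group $A$ whose underlying group is abelian, together with a split short exact sequence of $\mathrm{cat}^1$-groups $A\rightarrowtail E\rightleftarrows R$; a morphism of $R$-modules is a morphism $A\to A'$ inducing a morphism of split extensions which is the identity on $R$. For $f:Y\to R$, $\mathrm{Der}(Y,A)$ is the abelian group of maps $D:Y\to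 A$ commuting with $d_0,d_1$ and satisfying $D(yy')=D(y)+f(y)\cdot D(y')$; equivalently, of morphisms $Y\to E$ over $R$. Let $\mathbb G$ be the cotriple on $\mathrm{cat}^1$-groups given by the forgetful functor to sets and its left adjoint, and let $\mathbb G_*R\to R$, $\mathbb G_nR=\mathbb G^{n+1}R$, be the cotriple resolution. The cotriple cohomology is $D^n(R,A)=H^n\,\mathrm{Der}(\mathbb G_*R,A)$. For a crossed module $X$, an $X$-module is a crossed module $A$ with a $\mathcal G_X$-module structure on $\mathcal G_A$, a morphism of $X$-modules is a morphism of crossed modules that induces a morphism of $\mathcal G_X$-modules, and $D^n(X,A)=D^n(\mathcal G_X,\mathcal G_A)$. The category of crossed modules is called balanced if $D^n(X,I)=0$ for every crossed module $X$, every injective object $I$ of the category of $X$-modules and every $n>0$. **Theorem.** The functor $X\mapsto\mathcal G_X$ is an equivalence from crossed modules in groups to $\mathrm{cat}^1$-groups, and the category of crossed modules in groups, regarded through it as a category of interest, is not balanced: there are a crossed module $X$, an injective $X$-module $I$ and an integer $n>0$ with $D^n(X,I)\neq 0$. -/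

import Mathlib

open CategoryTheory

universe u

/-! ## Cat¹-groups -/

/-- A cat¹-group `(G, d₀, d₁)`: a group with two endomorphisms such that
`d₀ d₁ = d₁`, `d₁ d₀ = d₀` and `[ker d₀, ker d₁] = 1`. -/
structure Cat1Group : Type (u + 1) where
  carrier : Type u
  [group : Group carrier]
  d₀ : carrier →* carrier
  d₁ : carrier →* carrier
  d₀_d₁ : ∀ x, d₀ (d₁ x) = d₁ x
  d₁_d₀ : ∀ x, d₁ (d₀ x) = d₀ x
  commutator_ker : ⁅d₀.ker, d₁.ker⁆ = ⊥

namespace Cat1Group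

instance : CoeSort Cat1Group.{u} (Type u) := ⟨Cat1Group.carrier⟩

instance (G : Cat1Group.{u}) : Group G := G.group

/-- A morphism of cat¹-groups: a group homomorphism commuting with `d₀` and `d₁`. -/
@[ext]
structure Hom (G H : Cat1Group.{u}) : Type u where
  hom : G →* H
  map_d₀ : ∀ x, hom (G.d₀ x) = H.d₀ (hom x)
  map_d₁ : ∀ x, hom (G.d₁ x) = H.d₁ (hom x)

instance : Category.{u} Cat1Group.{u} where
  Hom G H := Hom G H
  id G := ⟨MonoidHom.id G, fun _ => rfl, fun _ => rfl⟩
  comp f g := ⟨g.hom.comp f.hom,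
    fun x => by simp [f.map_d₀, g.map_d₀], fun x => by simp [f.map_d₁, g.map_d₁]⟩

@[simp] theorem id_hom (G : Cat1Group.{u}) : Hom.hom (𝟙 G) = MonoidHom.id G := rfl

@[simp] theorem comp_hom {G H K : Cat1Group.{u}} (f : G ⟶ H) (g : H ⟶ K) :
    Hom.hom (f ≫ g) = (Hom.hom g).comp (Hom.hom f) := rfl

theorem hom_ext {G H : Cat1Group.{u}} {f g : G ⟶ H} (h : Hom.hom f = Hom.hom g) : f = g :=
  Hom.ext h

/-- The forgetful functor to sets. -/
def forgetSet : Cat1Group.{u} ⥤ Type u where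
  obj G := G
  map f := TypeCat.ofHom (Hom.hom f)

/-! ### The free cat¹-group on a set

The operations `d₀, d₁` generate the monoid `{1, d₀, d₁}` with `dᵢ dⱼ = dⱼ`. So the free group with
two such endomorphisms is the free group on three copies `x, d₀ x, d₁ x` of the given set, and the
free cat¹-group is its quotient by `[ker d₀, ker d₁]`. -/

namespace Free

/-- The elements of the monoid `{1, d₀, d₁}`. -/
inductive Op : Type
  | one : Op
  | d₀ : Op
  | d₁ : Op

/-- The free group on the letters `x, d₀ x, d₁ x`. -/
abbrev Pre (X : Type u) : Type u := FreeGroup (Op × X)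

/-- Left multiplication by `d₀` in the monoid `{1, d₀, d₁}`. -/
def op₀ : Op → Op
  | .one => .d₀
  | .d₀ => .d₀
  | .d₁ => .d₁

/-- Left multiplication by `d₁` in the monoid `{1, d₀, d₁}`. -/
def op₁ : Op → Op
  | .one => .d₁
  | .d₀ => .d₀
  | .d₁ => .d₁

/-- The endomorphism `d₀` of the free group on `x, d₀ x, d₁ x`. -/
def pre₀ (X : Type u) : Pre X →* Pre X := FreeGroup.map fun p => (op₀ p.1, p.2)

/-- The endomorphism `d₁` of the free group on `x, d₀ x, d₁ x`. -/
def pre₁ (X : Type u) : Pre X →* Pre X := FreeGroup.map fun p => (op₁ p.1, p.2)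

theorem pre₀_pre₁ {X : Type u} (x : Pre X) : pre₀ X (pre₁ X x) = pre₁ X x := by
  refine DFunLike.congr_fun (f := (pre₀ X).comp (pre₁ X)) (FreeGroup.ext_hom _ _ fun p => ?_) x
  obtain ⟨o, y⟩ := p
  cases o <;> simp [pre₀, pre₁, op₀, op₁]

theorem pre₁_pre₀ {X : Type u} (x : Pre X) : pre₁ X (pre₀ X x) = pre₀ X x := by
  refine DFunLike.congr_fun (f := (pre₁ X).comp (pre₀ X)) (FreeGroup.ext_hom _ _ fun p => ?_) x
  obtain ⟨o, y⟩ := p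
  cases o <;> simp [pre₀, pre₁, op₀, op₁]

theorem pre₀_pre₀ {X : Type u} (x : Pre X) : pre₀ X (pre₀ X x) = pre₀ X x := by
  rw [← pre₁_pre₀ x, pre₀_pre₁]

theorem pre₁_pre₁ {X : Type u} (x : Pre X) : pre₁ X (pre₁ X x) = pre₁ X x := by
  rw [← pre₀_pre₁ x, pre₁_pre₀]

/-- The normal subgroup `[ker d₀, ker d₁]`. -/
abbrev rel (X : Type u) : Subgroup (Pre X) := ⁅(pre₀ X).ker, (pre₁ X).ker⁆

theorem pre₀_rel {X : Type u} {x : Pre X} (hx : x ∈ rel X) : pre₀ X x = 1 :=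
  (MonoidHom.mem_ker).1 (Subgroup.commutator_le_left _ _ hx)

theorem pre₁_rel {X : Type u} {x : Pre X} (hx : x ∈ rel X) : pre₁ X x = 1 :=
  (MonoidHom.mem_ker).1 (Subgroup.commutator_le_right _ _ hx)

/-- The free cat¹-group on a set. -/
def obj (X : Type u) : Cat1Group.{u} where
  carrier := Pre X ⧸ rel X
  d₀ := QuotientGroup.map (rel X) (rel X) (pre₀ X) fun x hx => by
    rw [Subgroup.mem_comap, pre₀_rel hx]; exact one_mem _
  d₁ := QuotientGroup.map (rel X) (rel X) (pre₁ X) fun x hx => by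
    rw [Subgroup.mem_comap, pre₁_rel hx]; exact one_mem _
  d₀_d₁ x := by
    induction x using QuotientGroup.induction_on with
    | H x => simp [pre₀_pre₁]
  d₁_d₀ x := by
    induction x using QuotientGroup.induction_on with
    | H x => simp [pre₁_pre₀]
  commutator_ker := by
    rw [eq_bot_iff, Subgroup.commutator_le]
    intro x hx y hy
    induction x using QuotientGroup.induction_on with
    | H x =>
    induction y using QuotientGroup.induction_on with
    | H y =>
    rw [MonoidHom.mem_ker, QuotientGroup.map_mk, QuotientGroup.eq_one_iff] at hx hy
    have hx' : x ∈ (pre₀ X).ker := by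
      rw [MonoidHom.mem_ker, ← pre₀_pre₀]; exact pre₀_rel hx
    have hy' : y ∈ (pre₁ X).ker := by
      rw [MonoidHom.mem_ker, ← pre₁_pre₁]; exact pre₁_rel hy
    rw [Subgroup.mem_bot]
    exact (QuotientGroup.eq_one_iff _).2 (Subgroup.commutator_mem_commutator hx' hy')

/-- The inclusion of generators. -/
def ι {X : Type u} (x : X) : obj X :=
  QuotientGroup.mk (s := rel X) (FreeGroup.of (Op.one, x))

/-- The homomorphism from the free group on `x, d₀ x, d₁ x` extending a map `X → G`. -/
def preLift {X : Type u} {G : Cat1Group.{u}} (f : X → G) : Pre X →* G :=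
  FreeGroup.lift fun p => match p.1 with
    | .one => f p.2
    | .d₀ => G.d₀ (f p.2)
    | .d₁ => G.d₁ (f p.2)

theorem _root_.Cat1Group.d₀_d₀ (G : Cat1Group.{u}) (x : G) : G.d₀ (G.d₀ x) = G.d₀ x := by
  rw [← G.d₁_d₀ x, G.d₀_d₁]

theorem _root_.Cat1Group.d₁_d₁ (G : Cat1Group.{u}) (x : G) : G.d₁ (G.d₁ x) = G.d₁ x := by
  rw [← G.d₀_d₁ x, G.d₁_d₀]

theorem preLift_pre₀ {X : Type u} {G : Cat1Group.{u}} (f : X → G) (x : Pre X) :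
    preLift f (pre₀ X x) = G.d₀ (preLift f x) := by
  refine DFunLike.congr_fun (f := (preLift f).comp (pre₀ X)) (g := G.d₀.comp (preLift f))
    (FreeGroup.ext_hom _ _ fun p => ?_) x
  obtain ⟨o, y⟩ := p
  cases o <;> simp [pre₀, preLift, op₀, G.d₀_d₁, G.d₀_d₀]

theorem preLift_pre₁ {X : Type u} {G : Cat1Group.{u}} (f : X → G) (x : Pre X) :
    preLift f (pre₁ X x) = G.d₁ (preLift f x) := by
  refine DFunLike.congr_fun (f := (preLift f).comp (pre₁ X)) (g := G.d₁.comp (preLift f))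
    (FreeGroup.ext_hom _ _ fun p => ?_) x
  obtain ⟨o, y⟩ := p
  cases o <;> simp [pre₁, preLift, op₁, G.d₁_d₀, G.d₁_d₁]

theorem rel_le_ker {X : Type u} {G : Cat1Group.{u}} (f : X → G) : rel X ≤ (preLift f).ker := by
  rw [Subgroup.commutator_le]
  intro x hx y hy
  have h0 : preLift f x ∈ G.d₀.ker := by
    rw [MonoidHom.mem_ker, ← preLift_pre₀, MonoidHom.mem_ker.1 hx, map_one]
  have h1 : preLift f y ∈ G.d₁.ker := by
    rw [MonoidHom.mem_ker, ← preLift_pre₁, MonoidHom.mem_ker.1 hy, map_one]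
  have h := Subgroup.commutator_mem_commutator h0 h1
  rw [G.commutator_ker, Subgroup.mem_bot] at h
  rw [MonoidHom.mem_ker, map_commutatorElement, h]

/-- The morphism from the free cat¹-group extending a map `X → G`. -/
def lift {X : Type u} {G : Cat1Group.{u}} (f : X → G) : obj X ⟶ G where
  hom := QuotientGroup.lift (rel X) (preLift f) (rel_le_ker f)
  map_d₀ x := by
    induction x using QuotientGroup.induction_on with
    | H x => exact preLift_pre₀ f x
  map_d₁ x := by
    induction x using QuotientGroup.induction_on with
    | H x => exact preLift_pre₁ f x

@[simp] theorem lift_ι {X : Type u} {G : Cat1Group.{u}} (f : X → G) (x : X) :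
    Hom.hom (lift f) (ι x) = f x := by
  change preLift f (FreeGroup.of (Op.one, x)) = f x
  simp [preLift]

theorem free_ext {X : Type u} {G : Cat1Group.{u}} {f g : obj X ⟶ G}
    (h : ∀ x, Hom.hom f (ι x) = Hom.hom g (ι x)) : f = g := by
  apply hom_ext
  apply QuotientGroup.monoidHom_ext
  refine FreeGroup.ext_hom _ _ fun p => ?_
  obtain ⟨o, x⟩ := p
  cases o with
  | one => exact h x
  | d₀ =>
    exact (Hom.map_d₀ f _).trans ((congrArg G.d₀ (h x)).trans (Hom.map_d₀ g _).symm)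
  | d₁ =>
    exact (Hom.map_d₁ f _).trans ((congrArg G.d₁ (h x)).trans (Hom.map_d₁ g _).symm)

end Free

/-- The free functor from sets to cat¹-groups. -/
def free : Type u ⥤ Cat1Group.{u} where
  obj X := Free.obj X
  map f := Free.lift fun x => Free.ι (f x)
  map_id X := Free.free_ext fun x => by simp
  map_comp f g := Free.free_ext fun x => by simp

/-- The free functor is left adjoint to the forgetful functor. -/
def adj : free.{u} ⊣ forgetSet.{u} :=
  Adjunction.mkOfHomEquiv
    { homEquiv := fun X G =>
        { toFun := fun f => TypeCat.ofHom fun x => Hom.hom f (Free.ι x)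
          invFun := fun g => Free.lift (G := G) fun x => g x
          left_inv := fun f => Free.free_ext fun x => Free.lift_ι _ x
          right_inv := fun g => by
            ext x
            exact Free.lift_ι (G := G) (fun x => g x) x }
      homEquiv_naturality_left_symm := fun {X' X G} f g => Free.free_ext fun x => by
        refine (Free.lift_ι (G := G) (fun x => (f ≫ g) x) x).trans ?_
        exact ((congrArg (Hom.hom (Free.lift (G := G) fun x => g x))
          (Free.lift_ι (G := Free.obj X) (fun x => Free.ι (f x)) x)).trans
          (Free.lift_ι (G := G) (fun x => g x) (f x))).symm
      homEquiv_naturality_right := fun f g => rfl }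

/-- The cotriple `𝔾` on cat¹-groups given by the free–forgetful adjunction. -/
def cotriple : Comonad Cat1Group.{u} := adj.{u}.toComonad

/-! ### The cotriple resolution -/

/-- `cotripleIter R n = 𝔾ⁿ R`. The `n`-th object of the cotriple resolution of `R` is
`𝔾ⁿ⁺¹ R`. -/
def cotripleIter (R : Cat1Group.{u}) : ℕ → Cat1Group.{u}
  | 0 => R
  | n + 1 => cotriple.obj (cotripleIter R n)

/-- The face maps `𝔾ⁱ ε 𝔾ⁿ⁻ⁱ : 𝔾ⁿ⁺¹ R ⟶ 𝔾ⁿ R`, `0 ≤ i ≤ n`. -/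
def face (R : Cat1Group.{u}) : (n : ℕ) → Fin (n + 1) → (cotripleIter R (n + 1) ⟶ cotripleIter R n)
  | n, ⟨0, _⟩ => cotriple.ε.app (cotripleIter R n)
  | n + 1, ⟨i + 1, h⟩ => cotriple.map (face R n ⟨i, Nat.lt_of_succ_lt_succ h⟩)

/-- The augmentation `𝔾ⁿ R ⟶ R`, through which `𝔾ⁿ R` is an object over `R`. -/
def aug (R : Cat1Group.{u}) : (n : ℕ) → (cotripleIter R n ⟶ R)
  | 0 => 𝟙 R
  | n + 1 => cotriple.ε.app (cotripleIter R n) ≫ aug R n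

theorem face_aug (R : Cat1Group.{u}) : ∀ (n : ℕ) (i : Fin (n + 1)),
    face R n i ≫ aug R n = aug R (n + 1)
  | 0, ⟨0, _⟩ => rfl
  | _ + 1, ⟨0, _⟩ => rfl
  | n + 1, ⟨i + 1, h⟩ => by
    change cotriple.map (face R n ⟨i, _⟩) ≫ cotriple.ε.app _ ≫ aug R n = _
    rw [← Category.assoc]
    have := cotriple.ε.naturality (face R n ⟨i, Nat.lt_of_succ_lt_succ h⟩)
    rw [this, Category.assoc]
    exact congrArg _ (face_aug R n _)

/-- The simplicial identity `dᵢ dⱼ₊₁ = dⱼ dᵢ` for `i ≤ j`. -/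
theorem face_face (R : Cat1Group.{u}) : ∀ (n : ℕ) (i j : ℕ) (hij : i ≤ j) (hj : j < n + 1),
    face R (n + 1) ⟨j + 1, by omega⟩ ≫ face R n ⟨i, by omega⟩ =
      face R (n + 1) ⟨i, by omega⟩ ≫ face R n ⟨j, hj⟩
  | n, 0, j, _, hj => by
    have e : face R n ⟨0, by omega⟩ = cotriple.ε.app (cotripleIter R n) := by cases n <;> rfl
    rw [e]
    exact cotriple.ε.naturality (face R n ⟨j, hj⟩)
  | _, _ + 1, 0, hij, _ => absurd hij (Nat.not_succ_le_zero _)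
  | 0, _ + 1, j + 1, _, hj => absurd hj (by omega)
  | n + 1, i + 1, j + 1, hij, hj => by
    change cotriple.map (face R (n + 1) ⟨j + 1, _⟩) ≫ cotriple.map (face R n ⟨i, _⟩) =
      cotriple.map (face R (n + 1) ⟨i, _⟩) ≫ cotriple.map (face R n ⟨j, _⟩)
    rw [← Functor.map_comp, ← Functor.map_comp, face_face R n i j (by omega) (by omega)]

/-! ### Modules and derivations -/

/-- The structure of an `R`-module on `A`: the object `A` is singular (as the group operation is
the only binary operation, this says that the group `A` is abelian), and there is given a split
short exact sequence `A ↣ E ⇄ R` of cat¹-groups. -/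
structure ModuleStr (R A : Cat1Group.{u}) : Type (u + 1) where
  singular : ∀ a b : A, a * b = b * a
  E : Cat1Group.{u}
  i : A ⟶ E
  p : E ⟶ R
  s : R ⟶ E
  s_p : s ≫ p = 𝟙 R
  injective : Function.Injective (Hom.hom i)
  exact : (Hom.hom i).range = (Hom.hom p).ker

/-- A morphism `f : A ⟶ A'` is a morphism of `R`-modules if it induces a commutative diagram of
split extensions, with the identity on `R`. -/
def IsModuleHom {R A A' : Cat1Group.{u}} (S : ModuleStr R A) (S' : ModuleStr R A')
    (f : A ⟶ A') : Prop :=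
  ∃ g : S.E ⟶ S'.E, S.i ≫ g = f ≫ S'.i ∧ g ≫ S'.p = S.p ∧ S.s ≫ g = S'.s

theorem IsModuleHom.id {R A : Cat1Group.{u}} (S : ModuleStr R A) : IsModuleHom S S (𝟙 A) :=
  ⟨𝟙 _, by simp, by simp, by simp⟩

theorem IsModuleHom.comp {R A A' A'' : Cat1Group.{u}} {S : ModuleStr R A} {S' : ModuleStr R A'}
    {S'' : ModuleStr R A''} {f : A ⟶ A'} {f' : A' ⟶ A''} (h : IsModuleHom S S' f)
    (h' : IsModuleHom S' S'' f') : IsModuleHom S S'' (f ≫ f') := by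
  obtain ⟨g, h1, h2, h3⟩ := h
  obtain ⟨g', h1', h2', h3'⟩ := h'
  refine ⟨g ≫ g', ?_, ?_, ?_⟩
  · rw [← Category.assoc, h1, Category.assoc, h1', Category.assoc]
  · rw [Category.assoc, h2', h2]
  · rw [← Category.assoc, h3, h3']

/-- A derivation from an object `f : Y ⟶ R` over `R` to an `R`-module `A`: a map `D : Y → A` which
commutes with `d₀` and `d₁` and satisfies `D (y y') = D y + f y · D y'`, where `r ∈ R` acts on
`A ⊆ E` through conjugation by `s r`. -/
@[ext]
structure Der {R A Y : Cat1Group.{u}} (S : ModuleStr R A) (f : Y ⟶ R) : Type u where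
  toFun : Y → A
  map_mul : ∀ y y', Hom.hom S.i (toFun (y * y')) = Hom.hom S.i (toFun y) *
    (Hom.hom S.s (Hom.hom f y) * Hom.hom S.i (toFun y') * (Hom.hom S.s (Hom.hom f y))⁻¹)
  map_d₀ : ∀ y, toFun (Y.d₀ y) = A.d₀ (toFun y)
  map_d₁ : ∀ y, toFun (Y.d₁ y) = A.d₁ (toFun y)

namespace Der

variable {R A : Cat1Group.{u}} {S : ModuleStr R A}

theorem p_s (S : ModuleStr R A) (r : R) : Hom.hom S.p (Hom.hom S.s r) = r :=
  DFunLike.congr_fun (congrArg Hom.hom S.s_p) r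

theorem p_i (S : ModuleStr R A) (a : A) : Hom.hom S.p (Hom.hom S.i a) = 1 := by
  rw [← MonoidHom.mem_ker, ← S.exact]; exact ⟨a, rfl⟩

/-- The morphism `y ↦ D y · s (f y)` from `Y` to `E` given by a derivation. -/
def toHom {Y : Cat1Group.{u}} {f : Y ⟶ R} (D : Der S f) : Y ⟶ S.E where
  hom := MonoidHom.mk' (fun y => Hom.hom S.i (D.toFun y) * Hom.hom S.s (Hom.hom f y))
    fun y y' => by simp [D.map_mul, mul_assoc]
  map_d₀ y := by simp [D.map_d₀, Hom.map_d₀]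
  map_d₁ y := by simp [D.map_d₁, Hom.map_d₁]

theorem toHom_p {Y : Cat1Group.{u}} {f : Y ⟶ R} (D : Der S f) : D.toHom ≫ S.p = f := by
  apply hom_ext
  ext y
  simp [toHom, p_s, p_i]

/-- Derivations `Y → A` are the same as morphisms `Y ⟶ E` over `R`. -/
theorem toHom_bijective {Y : Cat1Group.{u}} (f : Y ⟶ R) :
    Function.Bijective fun D : Der S f => (⟨D.toHom, D.toHom_p⟩ : {φ : Y ⟶ S.E // φ ≫ S.p = f}) := by
  constructor
  · intro D D' h
    ext y
    have h1 := DFunLike.congr_fun (congrArg Hom.hom (congrArg Subtype.val h)) y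
    exact S.injective (mul_right_cancel h1)
  · rintro ⟨φ, hφ⟩
    have key : ∀ y, ∃ a, Hom.hom S.i a = Hom.hom φ y * (Hom.hom S.s (Hom.hom f y))⁻¹ := by
      intro y
      have h3 : Hom.hom S.p (Hom.hom φ y) = Hom.hom f y :=
        DFunLike.congr_fun (congrArg Hom.hom hφ) y
      have : Hom.hom φ y * (Hom.hom S.s (Hom.hom f y))⁻¹ ∈ (Hom.hom S.i).range := by
        rw [S.exact, MonoidHom.mem_ker, _root_.map_mul, map_inv, p_s, h3, mul_inv_cancel]
      exact this
    choose D hD using key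
    refine ⟨{ toFun := D, map_mul := ?_, map_d₀ := ?_, map_d₁ := ?_ }, ?_⟩
    · intro y y'
      rw [hD, hD, hD]
      simp [mul_assoc]
    · intro y
      apply S.injective
      rw [hD, Hom.map_d₀, Hom.map_d₀, Hom.map_d₀ S.i, hD]
      simp [Hom.map_d₀]
    · intro y
      apply S.injective
      rw [hD, Hom.map_d₁, Hom.map_d₁, Hom.map_d₁ S.i, hD]
      simp [Hom.map_d₁]
    · apply Subtype.ext
      apply hom_ext
      ext y
      simp [toHom, hD]

variable {Y : Cat1Group.{u}} {f : Y ⟶ R}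

theorem i_comm (S : ModuleStr R A) (a b : A) :
    Hom.hom S.i a * Hom.hom S.i b = Hom.hom S.i b * Hom.hom S.i a := by
  rw [← _root_.map_mul, S.singular, _root_.map_mul]

theorem conj_comm (S : ModuleStr R A) (a b : A) (r : R) :
    Hom.hom S.i a * (Hom.hom S.s r * Hom.hom S.i b * (Hom.hom S.s r)⁻¹) =
      (Hom.hom S.s r * Hom.hom S.i b * (Hom.hom S.s r)⁻¹) * Hom.hom S.i a := by
  have : Hom.hom S.s r * Hom.hom S.i b * (Hom.hom S.s r)⁻¹ ∈ (Hom.hom S.i).range := by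
    rw [S.exact, MonoidHom.mem_ker]
    simp [p_i]
  obtain ⟨c, hc⟩ := this
  rw [← hc, i_comm]

/-! Derivations form an abelian group under pointwise operations. -/

instance : Zero (Der S f) :=
  ⟨{ toFun := fun _ => 1
     map_mul := fun y y' => by simp
     map_d₀ := fun y => by simp
     map_d₁ := fun y => by simp }⟩

instance : Add (Der S f) :=
  ⟨fun D D' =>
   { toFun := fun y => D.toFun y * D'.toFun y
     map_mul := fun y y' => by
      have h := conj_comm S (D'.toFun y) (D.toFun y') (Hom.hom f y)
      rw [_root_.map_mul, _root_.map_mul, _root_.map_mul, D.map_mul, D'.map_mul, mul_assoc,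
        ← mul_assoc _ (Hom.hom S.i (D'.toFun y)), ← h]
      group
     map_d₀ := fun y => by rw [D.map_d₀, D'.map_d₀, _root_.map_mul]
     map_d₁ := fun y => by rw [D.map_d₁, D'.map_d₁, _root_.map_mul] }⟩

instance : Neg (Der S f) :=
  ⟨fun D =>
   { toFun := fun y => (D.toFun y)⁻¹
     map_mul := fun y y' => by
      rw [map_inv, D.map_mul, conj_comm, mul_inv_rev, map_inv, map_inv]
      group
     map_d₀ := fun y => by rw [D.map_d₀, map_inv]
     map_d₁ := fun y => by rw [D.map_d₁, map_inv] }⟩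

instance : AddCommGroup (Der S f) where
  add_assoc D D' D'' := Der.ext (funext fun _ => mul_assoc _ _ _)
  zero_add D := Der.ext (funext fun _ => one_mul _)
  add_zero D := Der.ext (funext fun _ => mul_one _)
  nsmul := nsmulRec
  zsmul := zsmulRec
  neg_add_cancel D := Der.ext (funext fun _ => inv_mul_cancel _)
  add_comm D D' := Der.ext (funext fun _ => S.singular _ _)

/-- The contravariant functoriality of derivations on objects over `R`. -/
def precomp {Y' : Cat1Group.{u}} {f' : Y' ⟶ R} (g : Y' ⟶ Y) (h : g ≫ f = f') :
    Der S f →+ Der S f' where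
  toFun D :=
    { toFun := fun y => D.toFun (Hom.hom g y)
      map_mul := fun y y' => by subst h; simp [D.map_mul]
      map_d₀ := fun y => by rw [Hom.map_d₀, D.map_d₀]
      map_d₁ := fun y => by rw [Hom.map_d₁, D.map_d₁] }
  map_zero' := rfl
  map_add' _ _ := rfl

theorem precomp_precomp {Y' Y'' : Cat1Group.{u}} {f' : Y' ⟶ R} {f'' : Y'' ⟶ R} (g : Y' ⟶ Y)
    (h : g ≫ f = f') (g' : Y'' ⟶ Y') (h' : g' ≫ f' = f'') (D : Der S f) :
    precomp g' h' (precomp g h D) =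
      precomp (g' ≫ g) (by rw [Category.assoc, h, h']) D := rfl

end Der

/-! ### Cotriple cohomology -/

section Cohomology

variable {R A : Cat1Group.{u}} (S : ModuleStr R A)

/-- The alternating sum `∑ (-1)ⁱ dᵢ^* : Der(𝔾ⁿ⁺¹ R, A) → Der(𝔾ⁿ⁺² R, A)`. -/
def coboundary (n : ℕ) : Der S (aug R (n + 1)) →+ Der S (aug R (n + 2)) :=
  ∑ i : Fin (n + 2), (-1 : ℤ) ^ (i : ℕ) • Der.precomp (face R (n + 1) i) (face_aug R (n + 1) i)

theorem coboundary_coboundary (n : ℕ) (D : Der S (aug R (n + 1))) :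
    coboundary S (n + 1) (coboundary S n D) = 0 := by
  simp only [coboundary, AddMonoidHom.finsetSum_apply, AddMonoidHom.coe_smul, Pi.smul_apply,
    map_sum, map_zsmul, Finset.smul_sum, smul_smul, ← pow_add]
  rw [← Finset.sum_product', Finset.univ_product_univ]
  let P := Fin (n + 2) × Fin (n + 3)
  let s : Finset P := Finset.univ.filter fun ij => (ij.2 : ℕ) ≤ ij.1
  rw [← Finset.sum_add_sum_compl s, ← eq_neg_iff_add_eq_zero, ← Finset.sum_neg_distrib]
  refine Finset.sum_bij (fun (ij : P) _ => ((⟨min (ij.2 : ℕ) (n + 1), by omega⟩, ij.1.succ) : P))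
    ?_ ?_ ?_ ?_
  · rintro ⟨⟨j, hj⟩, ⟨i, hi⟩⟩ h
    simp only [s, Finset.mem_filter, Finset.mem_univ, true_and, Finset.mem_compl] at h ⊢
    simp only [Fin.val_succ]
    omega
  · rintro ⟨⟨j, hj⟩, ⟨i, hi⟩⟩ h ⟨⟨j', hj'⟩, ⟨i', hi'⟩⟩ h' e
    simp only [s, Finset.mem_filter, Finset.mem_univ, true_and] at h h'
    have e1 := congrArg (fun ij : P => (ij.1 : ℕ)) e
    have e2 := congrArg (fun ij : P => (ij.2 : ℕ)) e
    simp only [Fin.val_succ] at e1 e2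
    have a : j = j' := by omega
    have b : i = i' := by omega
    subst a b
    rfl
  · rintro ⟨⟨j, hj⟩, ⟨i, hi⟩⟩ h
    simp only [s, Finset.mem_filter, Finset.mem_univ, true_and, Finset.mem_compl] at h
    refine ⟨(⟨i - 1, by omega⟩, ⟨j, by omega⟩), ?_, ?_⟩
    · simp only [s, Finset.mem_filter, Finset.mem_univ, true_and]
      omega
    · exact Prod.ext (Fin.ext (by dsimp; omega)) (Fin.ext (by dsimp; omega))
  · rintro ⟨⟨j, hj⟩, ⟨i, hi⟩⟩ h
    simp only [s, Finset.mem_filter, Finset.mem_univ, true_and] at h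
    have hmin : min i (n + 1) = i := by omega
    simp only [Der.precomp_precomp, Fin.succ_mk, hmin]
    have e := face_face R (n + 1) i j h hj
    have h2 : ((-1 : ℤ) ^ (i + (j + 1))) = - (-1) ^ (j + i) := by
      rw [pow_add, pow_add, pow_add]; ring
    rw [h2, neg_smul, neg_neg]
    simp only [e]

/-- The cochain complex `Der(𝔾_* R, A)`, where `𝔾_* R` is the cotriple resolution of `R`. -/
noncomputable def cotripleComplex : CochainComplex AddCommGrpCat.{u} ℕ :=
  CochainComplex.of (fun n => AddCommGrpCat.of (Der S (aug R (n + 1))))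
    (fun n => AddCommGrpCat.ofHom (coboundary S n))
    (fun n => by
      apply AddCommGrpCat.hom_ext
      ext1 D
      exact coboundary_coboundary S n D)

/-- The cotriple cohomology `Dⁿ(R, A) = Hⁿ Der(𝔾_* R, A)`. -/
noncomputable def cotripleCohomology (n : ℕ) : AddCommGrpCat.{u} := (cotripleComplex S).homology n

end Cohomology

end Cat1Group

/-! ## Crossed modules -/

/-- A crossed module `(T, G, μ)`: a homomorphism `μ : T → G` and an action of `G` on `T` by
automorphisms, such that `μ(ᵍt) = g μ(t) g⁻¹` and `^{μ(t)}t' = t t' t⁻¹`. -/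
structure CrossedModule : Type (u + 1) where
  T : Type u
  G : Type u
  [groupT : Group T]
  [groupG : Group G]
  μ : T →* G
  act : G →* MulAut T
  μ_act : ∀ g t, μ (act g t) = g * μ t * g⁻¹
  peiffer : ∀ t t', act (μ t) t' = t * t' * t⁻¹

namespace CrossedModule

attribute [instance] groupT groupG

/-- A morphism of crossed modules. -/
@[ext]
structure Hom (X Y : CrossedModule.{u}) : Type u where
  f : X.T →* Y.T
  h : X.G →* Y.G
  comm : ∀ t, Y.μ (f t) = h (X.μ t)
  equivariant : ∀ g t, f (X.act g t) = Y.act (h g) (f t)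

instance : Category.{u} CrossedModule.{u} where
  Hom X Y := Hom X Y
  id X := ⟨MonoidHom.id _, MonoidHom.id _, fun _ => rfl, fun _ _ => rfl⟩
  comp a b := ⟨b.f.comp a.f, b.h.comp a.h, fun t => by simp [a.comm, b.comm],
    fun g t => by simp [a.equivariant, b.equivariant]⟩

/-- The cat¹-group `(T ⋊ G, d₀, d₁)` of a crossed module, `d₀ (t, g) = (1, g)`,
`d₁ (t, g) = (1, μ(t) g)`. -/
def cat1Group (X : CrossedModule.{u}) : Cat1Group.{u} where
  carrier := X.T ⋊[X.act] X.G
  d₀ := SemidirectProduct.inr.comp SemidirectProduct.rightHom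
  d₁ := MonoidHom.mk' (fun x => ⟨1, X.μ x.left * x.right⟩) fun x y => by
    ext <;> simp [X.μ_act, mul_assoc]
  d₀_d₁ x := by ext <;> simp
  d₁_d₀ x := by ext <;> simp
  commutator_ker := by
    rw [eq_bot_iff, Subgroup.commutator_le]
    intro x hx y hy
    rw [Subgroup.mem_bot, commutatorElement_eq_one_iff_mul_comm]
    have hx' : x.right = 1 := by
      simpa using congrArg SemidirectProduct.right (MonoidHom.mem_ker.1 hx)
    have hy' : X.μ y.left * y.right = 1 := by
      simpa using congrArg SemidirectProduct.right (MonoidHom.mem_ker.1 hy)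
    have hy'' : y.right = X.μ (y.left⁻¹) := by
      rw [map_inv]; exact eq_inv_of_mul_eq_one_right hy'
    ext
    · simp [hx', hy'', X.peiffer, mul_assoc, -map_inv]
    · simp [hx']

/-- The functor from crossed modules to cat¹-groups. -/
def toCat1Group : CrossedModule.{u} ⥤ Cat1Group.{u} where
  obj X := X.cat1Group
  map {X Y} a :=
    { hom :=
        { toFun := fun x : X.T ⋊[X.act] X.G =>
            (⟨Hom.f a x.left, Hom.h a x.right⟩ : Y.T ⋊[Y.act] Y.G)
          map_one' := SemidirectProduct.ext (map_one _) (map_one _)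
          map_mul' := fun x y => SemidirectProduct.ext
            ((map_mul (Hom.f a) _ _).trans (congrArg (_ * ·) (Hom.equivariant a _ _)))
            (map_mul (Hom.h a) _ _) }
      map_d₀ := fun x => SemidirectProduct.ext (map_one (Hom.f a)) rfl
      map_d₁ := fun x => SemidirectProduct.ext (map_one (Hom.f a))
        ((map_mul (Hom.h a) _ _).trans (congrArg (· * _) (Hom.comm a _).symm)) }

/-- A module over a crossed module `X`: a crossed module whose cat¹-group is a module over the
cat¹-group of `X`. -/
structure Mod (X : CrossedModule.{u}) : Type (u + 1) where
  obj : CrossedModule.{u}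
  str : Cat1Group.ModuleStr (toCat1Group.obj X) (toCat1Group.obj obj)

/-- A morphism of modules over a crossed module `X`: a morphism of crossed modules such that the
corresponding morphism of cat¹-groups is a morphism of modules. -/
@[ext]
structure Mod.Hom {X : CrossedModule.{u}} (A B : Mod X) : Type u where
  hom : A.obj ⟶ B.obj
  isModuleHom : Cat1Group.IsModuleHom A.str B.str (toCat1Group.map hom)

instance (X : CrossedModule.{u}) : Category.{u} (Mod X) where
  Hom A B := Mod.Hom A B
  id A := ⟨𝟙 _, by rw [CategoryTheory.Functor.map_id]; exact .id _⟩
  comp a b := ⟨a.hom ≫ b.hom, by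
    rw [CategoryTheory.Functor.map_comp]; exact a.isModuleHom.comp b.isModuleHom⟩

/-- Crossed modules, considered as a category of interest through cat¹-groups, are balanced if
`Dⁿ(X, I) = 0` for every crossed module `X`, every injective `X`-module `I` and every `n > 0`. -/
def IsBalanced : Prop :=
  ∀ (X : CrossedModule.{u}) (I : Mod X), Injective I →
    ∀ n : ℕ, 0 < n → Limits.IsZero (Cat1Group.cotripleCohomology I.str n)

end CrossedModule

/-! For the equivalence: `d₀` is idempotent, so a cat¹-group splits as `ker d₀ ⋊ im d₀`, and `[ker
d₀, ker d₁] = 1` yields the Peiffer identity for `d₁ : ker d₀ → im d₀`.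

Balance already fails for `n = 1` and `X = (T → 1)` with `T` abelian. If `D¹(X, I) = 0`, every
singular extension of `X` by `I` splits (`exists_splitting_of_isZero`), so it suffices to find an
injective `I` and an extension by `I` that does not split.

A module `A` over `T → 1` is a homomorphism `μ : A_T → A_G` of abelian groups with a bilinear
pairing `T × A_G → A_T` that vanishes on the image of `μ`. The functor `A ↦ A_T` has a left adjoint,
`K ↦ (K = K)` with zero pairing, and a right adjoint, `D ↦ (D → Hom(T, D))` with trivial boundary
and evaluation, up to sign, as pairing. Because of the left adjoint it preserves monomorphisms, so
the right adjoint sends divisible groups to injectives (`injective_dualMod`).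

A bilinear `β : T × T → D` gives a central extension `H` of `T` by `D`, and the commutator pairing
makes `H → Hom(T, D)` a crossed module extending `T → 1` by this coefficient module. A splitting
would lift each `t` to an element of `H` with trivial boundary, which forces `β(t, ·) = β(·, t)`
(`heisenbergExt_not_split`). A non-symmetric form on `ℚ²` with values in `ℚ` therefore gives the
counterexample. -/

theorem Cat1Group.mul_comm_of_ker (G : Cat1Group.{u}) {x y : G} (hx : G.d₀ x = 1)
    (hy : G.d₁ y = 1) : x * y = y * x := by
  have h := Subgroup.commutator_mem_commutator (H₁ := G.d₀.ker) (H₂ := G.d₁.ker) hx hy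
  rwa [G.commutator_ker, Subgroup.mem_bot, commutatorElement_eq_one_iff_mul_comm] at h

/-! ### The equivalence between crossed modules and cat¹-groups -/

namespace CrossedModule

open Cat1Group

instance : toCat1Group.{u}.Faithful where
  map_injective {X Y a b} h := by
    have key := fun x => DFunLike.congr_fun (congrArg Cat1Group.Hom.hom h) x
    refine Hom.ext (MonoidHom.ext fun t => ?_) (MonoidHom.ext fun g => ?_)
    · exact congrArg SemidirectProduct.left (key (SemidirectProduct.inl t : X.T ⋊[X.act] X.G))
    · exact congrArg SemidirectProduct.right (key (SemidirectProduct.inr g : X.T ⋊[X.act] X.G))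

section Full

variable {X Y : CrossedModule.{u}} (φ : toCat1Group.obj X ⟶ toCat1Group.obj Y)

/-- A homomorphism between the cat¹-groups of crossed modules, with explicit semidirect products. -/
def semidirectHom : X.T ⋊[X.act] X.G →* Y.T ⋊[Y.act] Y.G := Cat1Group.Hom.hom φ

theorem semidirectHom_inr (g : X.G) :
    semidirectHom φ (SemidirectProduct.inr g) =
      SemidirectProduct.inr (semidirectHom φ (SemidirectProduct.inr g)).right :=
  Cat1Group.Hom.map_d₀ φ (SemidirectProduct.inr g : X.T ⋊[X.act] X.G)

theorem semidirectHom_inl (t : X.T) :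
    semidirectHom φ (SemidirectProduct.inl t) =
      SemidirectProduct.inl (semidirectHom φ (SemidirectProduct.inl t)).left := by
  -- The subgroup `T` is the kernel of `d₀`, and `φ` preserves this kernel.
  have h := Cat1Group.Hom.map_d₀ φ (SemidirectProduct.inl t : X.T ⋊[X.act] X.G)
  have e : (toCat1Group.obj X).d₀ (SemidirectProduct.inl t : X.T ⋊[X.act] X.G) = 1 := rfl
  rw [e, map_one] at h
  have h' : 1 = (semidirectHom φ (SemidirectProduct.inl t)).right :=
    congrArg SemidirectProduct.right h
  exact SemidirectProduct.ext rfl h'.symm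

/-- The morphism of crossed modules underlying a morphism of the associated cat¹-groups. -/
def preimageHom : X ⟶ Y where
  f := MonoidHom.mk' (fun t => (semidirectHom φ (SemidirectProduct.inl t)).left) fun a b => by
    rw [map_mul, map_mul, semidirectHom_inl φ a, semidirectHom_inl φ b]
    simp
  h := MonoidHom.mk' (fun g => (semidirectHom φ (SemidirectProduct.inr g)).right) fun a b => by
    rw [map_mul, map_mul, SemidirectProduct.mul_right]
  comm t := by
    have h : semidirectHom φ (SemidirectProduct.inr (X.μ t * 1)) =
        SemidirectProduct.inr (Y.μ (semidirectHom φ (SemidirectProduct.inl t)).left *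
          (semidirectHom φ (SemidirectProduct.inl t)).right) :=
      Cat1Group.Hom.map_d₁ φ (SemidirectProduct.inl t : X.T ⋊[X.act] X.G)
    rw [semidirectHom_inl φ t, mul_one] at h
    have := congrArg SemidirectProduct.right h
    simpa using this.symm
  equivariant g t := by
    change (semidirectHom φ (SemidirectProduct.inl (X.act g t))).left =
      Y.act (semidirectHom φ (SemidirectProduct.inr g)).right
        (semidirectHom φ (SemidirectProduct.inl t)).left
    rw [SemidirectProduct.inl_aut, map_mul, map_mul, map_inv, map_inv, semidirectHom_inl φ t,
      semidirectHom_inr φ g, ← map_inv, ← SemidirectProduct.inl_aut]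
    simp

end Full

instance : toCat1Group.{u}.Full where
  map_surjective {X Y} φ := by
    refine ⟨preimageHom φ, Cat1Group.hom_ext (SemidirectProduct.hom_ext (φ := X.act)
      (f := semidirectHom (toCat1Group.map (preimageHom φ))) (g := semidirectHom φ) ?_ ?_)⟩
    · ext1 t
      refine Eq.trans (b := SemidirectProduct.inl (semidirectHom φ (SemidirectProduct.inl t)).left)
        (SemidirectProduct.ext rfl ?_) (semidirectHom_inl φ t).symm
      exact map_one (Hom.h (preimageHom φ))
    · ext1 g
      refine Eq.trans
        (b := SemidirectProduct.inr (semidirectHom φ (SemidirectProduct.inr g)).right)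
        (SemidirectProduct.ext ?_ rfl) (semidirectHom_inr φ g).symm
      exact map_one (Hom.f (preimageHom φ))

section EssSurj

variable (G : Cat1Group.{u})

/-- The crossed module `ker d₀ → im d₀` of a cat¹-group. -/
def ofCat1Group : CrossedModule.{u} where
  T := G.d₀.ker
  G := G.d₀.range
  μ := (G.d₁.comp G.d₀.ker.subtype).codRestrict G.d₀.range fun t => ⟨G.d₁ t, G.d₀_d₁ t⟩
  act := MulAut.conjNormal.comp G.d₀.range.subtype
  μ_act := by
    rintro ⟨_, x, rfl⟩ t
    apply Subtype.ext
    change G.d₁ (G.d₀ x * t * (G.d₀ x)⁻¹) = G.d₀ x * G.d₁ t * (G.d₀ x)⁻¹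
    simp [G.d₁_d₀]
  peiffer t t' := by
    apply Subtype.ext
    -- As `d₁` is idempotent, `t⁻¹ d₁(t)` lies in `ker d₁` and so commutes with `t' ∈ ker d₀`. Hence
    -- `t` and `d₁(t)` conjugate `t'` in the same way.
    have h : (t' : G) * ((t : G)⁻¹ * G.d₁ t) = (t : G)⁻¹ * G.d₁ t * t' :=
      G.mul_comm_of_ker t'.2 (by simp [G.d₁_d₁])
    change G.d₁ t * t' * (G.d₁ t)⁻¹ = t * t' * (t : G)⁻¹
    rw [mul_inv_eq_iff_eq_mul]
    calc G.d₁ t * t' = t * ((t : G)⁻¹ * G.d₁ t * t') := by group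
      _ = t * t' * (t : G)⁻¹ * G.d₁ t := by rw [← h]; group

theorem d₀_of_mem_range {g : G} (hg : g ∈ G.d₀.range) : G.d₀ g = g := by
  obtain ⟨x, rfl⟩ := hg
  exact G.d₀_d₀ x

/-- The cat¹-group of the crossed module of a cat¹-group `G` is isomorphic to `G`. -/
def ofCat1GroupIso : toCat1Group.obj (ofCat1Group G) ≅ G where
  hom :=
    { hom := MonoidHom.mk' (fun x : (ofCat1Group G).T ⋊[(ofCat1Group G).act] (ofCat1Group G).G =>
          (x.left.1 * x.right.1 : G)) fun x y => by
        change x.left.1 * (x.right.1 * y.left.1 * x.right.1⁻¹) * (x.right.1 * y.right.1) = _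
        group
      map_d₀ := fun (x : (ofCat1Group G).T ⋊[(ofCat1Group G).act] (ofCat1Group G).G) => by
        change 1 * x.right.1 = G.d₀ (x.left.1 * x.right.1)
        rw [map_mul, MonoidHom.mem_ker.1 x.left.2, d₀_of_mem_range G x.right.2]
      map_d₁ := fun (x : (ofCat1Group G).T ⋊[(ofCat1Group G).act] (ofCat1Group G).G) => by
        change 1 * (G.d₁ x.left.1 * x.right.1) = G.d₁ (x.left.1 * x.right.1)
        rw [map_mul, one_mul]
        nth_rw 2 [← d₀_of_mem_range G x.right.2]
        rw [G.d₁_d₀, d₀_of_mem_range G x.right.2] }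
  inv :=
    -- The decomposition `x = (x d₀(x)⁻¹) d₀(x)` along the idempotent `d₀`.
    { hom := MonoidHom.mk' (fun x => (⟨⟨x * (G.d₀ x)⁻¹, by
          simp [MonoidHom.mem_ker, G.d₀_d₀]⟩, ⟨G.d₀ x, x, rfl⟩⟩ :
            (ofCat1Group G).T ⋊[(ofCat1Group G).act] (ofCat1Group G).G)) fun x y => by
          refine SemidirectProduct.ext (Subtype.ext ?_) (Subtype.ext (map_mul _ _ _))
          change x * y * (G.d₀ (x * y))⁻¹ =
            x * (G.d₀ x)⁻¹ * (G.d₀ x * (y * (G.d₀ y)⁻¹) * (G.d₀ x)⁻¹)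
          rw [map_mul]
          group
      map_d₀ := fun x => by
        refine SemidirectProduct.ext (Subtype.ext ?_) (Subtype.ext (G.d₀_d₀ x))
        change G.d₀ x * (G.d₀ (G.d₀ x))⁻¹ = 1
        rw [G.d₀_d₀, mul_inv_cancel]
      map_d₁ := fun x => by
        refine SemidirectProduct.ext (Subtype.ext ?_) (Subtype.ext ?_)
        · change G.d₁ x * (G.d₀ (G.d₁ x))⁻¹ = 1
          rw [G.d₀_d₁, mul_inv_cancel]
        · change G.d₀ (G.d₁ x) = G.d₁ (x * (G.d₀ x)⁻¹) * G.d₀ x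
          rw [map_mul, map_inv, G.d₀_d₁, G.d₁_d₀, inv_mul_cancel_right] }
  hom_inv_id := by
    refine Cat1Group.hom_ext (MonoidHom.ext
      fun (x : (ofCat1Group G).T ⋊[(ofCat1Group G).act] (ofCat1Group G).G) => ?_)
    have h : G.d₀ (x.left.1 * x.right.1) = x.right.1 := by
      rw [map_mul, MonoidHom.mem_ker.1 x.left.2, d₀_of_mem_range G x.right.2, one_mul]
    refine SemidirectProduct.ext (Subtype.ext ?_) (Subtype.ext h)
    change x.left.1 * x.right.1 * (G.d₀ (x.left.1 * x.right.1))⁻¹ = x.left.1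
    rw [h, mul_inv_cancel_right]
  inv_hom_id := by
    refine Cat1Group.hom_ext (MonoidHom.ext fun x => ?_)
    exact inv_mul_cancel_right x (G.d₀ x)

end EssSurj

instance : toCat1Group.{u}.EssSurj where
  mem_essImage G := ⟨ofCat1Group G, ⟨ofCat1GroupIso G⟩⟩

instance : toCat1Group.{u}.IsEquivalence where

end CrossedModule

namespace Cat1Group

/-! ### The action on a module -/

namespace ModuleStr

variable {R A : Cat1Group.{u}} (S : ModuleStr R A)

theorem exists_act (r : R) (a : A) :
    ∃ b, Hom.hom S.i b = Hom.hom S.s r * Hom.hom S.i a * (Hom.hom S.s r)⁻¹ := by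
  have : Hom.hom S.s r * Hom.hom S.i a * (Hom.hom S.s r)⁻¹ ∈ (Hom.hom S.i).range := by
    rw [S.exact, MonoidHom.mem_ker]
    simp [Der.p_i]
  exact this

/-- The action of `R` on an `R`-module. -/
noncomputable def act (r : R) (a : A) : A := (S.exists_act r a).choose

theorem i_act (r : R) (a : A) :
    Hom.hom S.i (S.act r a) = Hom.hom S.s r * Hom.hom S.i a * (Hom.hom S.s r)⁻¹ :=
  (S.exists_act r a).choose_spec

theorem act_eq {r : R} {a b : A}
    (h : Hom.hom S.s r * Hom.hom S.i a = Hom.hom S.i b * Hom.hom S.s r) : S.act r a = b :=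
  S.injective (by rw [i_act, mul_inv_eq_iff_eq_mul, h])

theorem act_mul (r : R) (a b : A) : S.act r (a * b) = S.act r a * S.act r b :=
  S.injective (by simp [i_act])

theorem mul_act (r r' : R) (a : A) : S.act (r * r') a = S.act r (S.act r' a) :=
  S.injective (by simp [i_act, mul_assoc])

theorem one_act (a : A) : S.act 1 a = a := S.injective (by simp [i_act])

theorem d₀_act (r : R) (a : A) : A.d₀ (S.act r a) = S.act (R.d₀ r) (A.d₀ a) :=
  S.injective (by simp [i_act, Hom.map_d₀])

/-- In `E`, the images of `a` and `r` lie in `ker d₀` and `ker d₁` respectively, so they commute.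
This and its mirror image are the constraints that the cat¹-condition on `E` puts on the action. -/
theorem act_of_d₁_eq_one {r : R} {a : A} (hr : R.d₁ r = 1) (ha : A.d₀ a = 1) : S.act r a = a := by
  apply S.injective
  rw [i_act, mul_inv_eq_iff_eq_mul]
  refine (S.E.mul_comm_of_ker ?_ ?_).symm
  · rw [← Hom.map_d₀, ha, map_one]
  · rw [← Hom.map_d₁, hr, map_one]

theorem act_of_d₀_eq_one {r : R} {a : A} (hr : R.d₀ r = 1) (ha : A.d₁ a = 1) : S.act r a = a := by
  apply S.injective
  rw [i_act, mul_inv_eq_iff_eq_mul]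
  refine S.E.mul_comm_of_ker ?_ ?_
  · rw [← Hom.map_d₀, hr, map_one]
  · rw [← Hom.map_d₁, ha, map_one]

/-- A morphism is a morphism of `R`-modules if and only if it is equivariant. -/
theorem _root_.Cat1Group.isModuleHom_iff {A' : Cat1Group.{u}} (S' : ModuleStr R A') (f : A ⟶ A') :
    IsModuleHom S S' f ↔ ∀ r a, Hom.hom f (S.act r a) = S'.act r (Hom.hom f a) := by
  constructor
  · rintro ⟨g, h1, -, h3⟩ r a
    have h1' : ∀ a, Hom.hom S'.i (Hom.hom f a) = Hom.hom g (Hom.hom S.i a) := fun a =>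
      (DFunLike.congr_fun (congrArg Hom.hom h1) a).symm
    have h3' : ∀ r, Hom.hom S'.s r = Hom.hom g (Hom.hom S.s r) := fun r =>
      (DFunLike.congr_fun (congrArg Hom.hom h3) r).symm
    apply S'.injective
    rw [i_act, h1', h1', h3', i_act]
    simp
  · intro h
    -- The identity of `E` corresponds to the derivation `e ↦ e · s(p e)⁻¹`. Composed with the
    -- equivariant `f`, it is again a derivation, whose morphism to `S'.E` is the required map of
    -- extensions.
    obtain ⟨D, hD⟩ := (Der.toHom_bijective (S := S) S.p).2 ⟨𝟙 _, Category.id_comp _⟩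
    have hD' : ∀ e, Hom.hom S.i (D.toFun e) * Hom.hom S.s (Hom.hom S.p e) = e := fun e =>
      DFunLike.congr_fun (congrArg Hom.hom (congrArg Subtype.val hD)) e
    let D' : Der S' S.p :=
      { toFun := fun e => Hom.hom f (D.toFun e)
        map_mul := fun e e' => by
          have : D.toFun (e * e') = D.toFun e * S.act (Hom.hom S.p e) (D.toFun e') :=
            S.injective (by rw [D.map_mul, map_mul, i_act])
          rw [this, map_mul, map_mul, h, i_act]
        map_d₀ := fun e => by rw [D.map_d₀, Hom.map_d₀]
        map_d₁ := fun e => by rw [D.map_d₁, Hom.map_d₁] }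
    refine ⟨D'.toHom, ?_, D'.toHom_p, ?_⟩
    · apply hom_ext
      ext a
      have h1 := hD' (Hom.hom S.i a)
      rw [Der.p_i, map_one, mul_one] at h1
      have h2 : D.toFun (Hom.hom S.i a) = a := S.injective h1
      change Hom.hom S'.i (Hom.hom f (D.toFun (Hom.hom S.i a))) *
        Hom.hom S'.s (Hom.hom S.p (Hom.hom S.i a)) = Hom.hom S'.i (Hom.hom f a)
      rw [h2, Der.p_i, map_one, mul_one]
    · apply hom_ext
      ext r
      have h1 := hD' (Hom.hom S.s r)
      rw [Der.p_s] at h1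
      have h2 : D.toFun (Hom.hom S.s r) = 1 := S.injective (by
        rw [map_one]; exact mul_eq_right.1 h1)
      change Hom.hom S'.i (Hom.hom f (D.toFun (Hom.hom S.s r))) *
        Hom.hom S'.s (Hom.hom S.p (Hom.hom S.s r)) = Hom.hom S'.s r
      rw [h2, Der.p_s, map_one, map_one, one_mul]

end ModuleStr

/-! ### The first cohomology and singular extensions -/

/-- A singular extension of `R` by an `R`-module. -/
structure SingularExt {R A : Cat1Group.{u}} (S : ModuleStr R A) where
  E : Cat1Group.{u}
  j : A ⟶ E
  q : E ⟶ R
  injective : Function.Injective (Hom.hom j)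
  surjective : Function.Surjective (Hom.hom q)
  exact : (Hom.hom j).range = (Hom.hom q).ker
  j_act : ∀ e a, Hom.hom j (S.act (Hom.hom q e) a) = e * Hom.hom j a * e⁻¹

namespace SingularExt

variable {R A : Cat1Group.{u}} {S : ModuleStr R A} (P : SingularExt S)

section

variable {Y : Cat1Group.{u}} {f : Y ⟶ R}

theorem q_j (a : A) : Hom.hom P.q (Hom.hom P.j a) = 1 := by
  rw [← MonoidHom.mem_ker, ← P.exact]; exact ⟨a, rfl⟩

theorem q_apply {φ : Y ⟶ P.E} (hφ : φ ≫ P.q = f) (y : Y) :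
    Hom.hom P.q (Hom.hom φ y) = Hom.hom f y :=
  DFunLike.congr_fun (congrArg Hom.hom hφ) y

theorem exists_diff {φ ψ : Y ⟶ P.E} (hφ : φ ≫ P.q = f) (hψ : ψ ≫ P.q = f) (y : Y) :
    ∃ a, Hom.hom P.j a = Hom.hom φ y * (Hom.hom ψ y)⁻¹ := by
  have : Hom.hom φ y * (Hom.hom ψ y)⁻¹ ∈ (Hom.hom P.j).range := by
    rw [P.exact, MonoidHom.mem_ker, map_mul, map_inv, P.q_apply hφ, P.q_apply hψ, mul_inv_cancel]
  exact this

/-- The difference of two morphisms to a singular extension with the same projection. -/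
noncomputable def diff (φ ψ : Y ⟶ P.E) (hφ : φ ≫ P.q = f) (hψ : ψ ≫ P.q = f) : Der S f where
  toFun y := (P.exists_diff hφ hψ y).choose
  map_mul y y' := by
    rw [← S.i_act, ← map_mul]
    congr 1
    apply P.injective
    refine (P.exists_diff hφ hψ _).choose_spec.trans ?_
    rw [map_mul (Hom.hom P.j), ← P.q_apply hψ, P.j_act, (P.exists_diff hφ hψ _).choose_spec,
      (P.exists_diff hφ hψ _).choose_spec]
    simp [mul_assoc]
  map_d₀ y := by
    apply P.injective
    rw [Hom.map_d₀ P.j, (P.exists_diff hφ hψ _).choose_spec, (P.exists_diff hφ hψ _).choose_spec]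
    simp [Hom.map_d₀]
  map_d₁ y := by
    apply P.injective
    rw [Hom.map_d₁ P.j, (P.exists_diff hφ hψ _).choose_spec, (P.exists_diff hφ hψ _).choose_spec]
    simp [Hom.map_d₁]

theorem j_diff {φ ψ : Y ⟶ P.E} (hφ : φ ≫ P.q = f) (hψ : ψ ≫ P.q = f) (y : Y) :
    Hom.hom P.j ((P.diff φ ψ hφ hψ).toFun y) = Hom.hom φ y * (Hom.hom ψ y)⁻¹ :=
  (P.exists_diff hφ hψ y).choose_spec

theorem diff_add_diff {φ ψ χ : Y ⟶ P.E} (hφ : φ ≫ P.q = f) (hψ : ψ ≫ P.q = f)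
    (hχ : χ ≫ P.q = f) :
    P.diff φ ψ hφ hψ + P.diff ψ χ hψ hχ = P.diff φ χ hφ hχ := by
  refine Der.ext (funext fun y => P.injective ?_)
  refine (map_mul (Hom.hom P.j) _ _).trans ?_
  rw [j_diff, j_diff, j_diff]
  group

/-- The translate of a morphism to a singular extension by a derivation. -/
noncomputable def translate (D : Der S f) (φ : Y ⟶ P.E) (hφ : φ ≫ P.q = f) : Y ⟶ P.E where
  hom := MonoidHom.mk' (fun y => Hom.hom P.j (D.toFun y) * Hom.hom φ y) fun y y' => by
    have : D.toFun (y * y') = D.toFun y * S.act (Hom.hom f y) (D.toFun y') :=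
      S.injective (by rw [D.map_mul, map_mul, S.i_act])
    rw [this, map_mul, ← P.q_apply hφ, P.j_act, map_mul]
    simp [mul_assoc]
  map_d₀ y := by simp [D.map_d₀, Hom.map_d₀]
  map_d₁ y := by simp [D.map_d₁, Hom.map_d₁]

theorem translate_apply (D : Der S f) (φ : Y ⟶ P.E) (hφ : φ ≫ P.q = f) (y : Y) :
    Hom.hom (P.translate D φ hφ) y = Hom.hom P.j (D.toFun y) * Hom.hom φ y := rfl

end

/-! ### The class of a singular extension in degree one -/

/-- The inclusion of generators `𝔾ⁿ R → 𝔾ⁿ⁺¹ R`. -/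
def gen (n : ℕ) (x : cotripleIter R n) : cotripleIter R (n + 1) := Free.ι (X := cotripleIter R n) x

theorem aug_one_gen (x : R) : Hom.hom (aug R 1) (gen 0 x) = x :=
  Free.lift_ι (G := R) (fun x => x) x

theorem face_zero_gen (x : cotripleIter R 1) : Hom.hom (face R 1 0) (gen 1 x) = x :=
  Free.lift_ι (G := cotripleIter R 1) (fun x => x) x

theorem face_one_gen (x : cotripleIter R 1) :
    Hom.hom (face R 1 1) (gen 1 x) = gen 0 (Hom.hom (aug R 1) x) :=
  Free.lift_ι _ x

/-- The morphism from the free cat¹-group on `R` to the extension given by a section. -/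
noncomputable def freeSection : cotripleIter R 1 ⟶ P.E :=
  Free.lift (X := R) (Function.surjInv P.surjective)

theorem freeSection_q : P.freeSection ≫ P.q = aug R 1 := by
  refine Free.free_ext (X := R) fun x => ?_
  refine (congrArg (Hom.hom P.q) (Free.lift_ι (X := R) _ x)).trans ?_
  exact (Function.surjInv_eq P.surjective x).trans (aug_one_gen x).symm

theorem face_freeSection_q (i : Fin 2) : (face R 1 i ≫ P.freeSection) ≫ P.q = aug R 2 := by
  rw [Category.assoc, freeSection_q, face_aug]

/-- The cocycle of a singular extension. -/
noncomputable def cocycle : Der S (aug R 2) :=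
  P.diff (face R 1 0 ≫ P.freeSection) (face R 1 1 ≫ P.freeSection)
    (P.face_freeSection_q 0) (P.face_freeSection_q 1)

/-- By the simplicial identities only three composites `φ, ψ, χ : 𝔾³ R → 𝔾 R → E` occur, and the
alternating sum is `(φ - ψ) - (φ - χ) + (ψ - χ)`. -/
theorem coboundary_cocycle : coboundary S 1 P.cocycle = 0 := by
  have key : ∀ i : Fin 3, Der.precomp (face R 2 i) (face_aug R 2 i) P.cocycle =
      P.diff (face R 2 i ≫ face R 1 0 ≫ P.freeSection) (face R 2 i ≫ face R 1 1 ≫ P.freeSection)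
        (by rw [Category.assoc, face_freeSection_q, face_aug])
        (by rw [Category.assoc, face_freeSection_q, face_aug]) := fun i =>
    Der.ext (funext fun y => P.injective (by
      rw [j_diff]
      exact P.j_diff (P.face_freeSection_q 0) (P.face_freeSection_q 1) _))
  have h00 : face R 2 1 ≫ face R 1 0 = face R 2 0 ≫ face R 1 0 :=
    face_face R 1 0 0 le_rfl (by omega)
  have h01 : face R 2 2 ≫ face R 1 0 = face R 2 0 ≫ face R 1 1 :=
    face_face R 1 0 1 (by omega) (by omega)
  have h11 : face R 2 2 ≫ face R 1 1 = face R 2 1 ≫ face R 1 1 :=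
    face_face R 1 1 1 le_rfl (by omega)
  rw [coboundary, AddMonoidHom.finsetSum_apply, Fin.sum_univ_three]
  simp only [AddMonoidHom.coe_smul, Pi.smul_apply]
  rw [key, key, key]
  simp only [← Category.assoc, h00, h01, h11]
  have h := P.diff_add_diff (φ := (face R 2 0 ≫ face R 1 0) ≫ P.freeSection)
    (ψ := (face R 2 0 ≫ face R 1 1) ≫ P.freeSection)
    (χ := (face R 2 1 ≫ face R 1 1) ≫ P.freeSection) (f := aug R 3)
    (by rw [Category.assoc, Category.assoc, freeSection_q, face_aug, face_aug])
    (by rw [Category.assoc, Category.assoc, freeSection_q, face_aug, face_aug])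
    (by rw [Category.assoc, Category.assoc, freeSection_q, face_aug, face_aug])
  rw [← h]
  simp

/-- If the class of a singular extension vanishes, then the extension splits. -/
theorem exists_splitting (D : Der S (aug R 1)) (hD : coboundary S 0 D = P.cocycle) :
    ∃ σ : R ⟶ P.E, σ ≫ P.q = 𝟙 R := by
  -- The cocycle measures how far `freeSection` is from equalizing the two faces. Translating by
  -- `-D` removes this defect, so `τ` descends along the augmentation.
  let τ := P.translate (-D) P.freeSection P.freeSection_q
  have hτq : ∀ x, Hom.hom P.q (Hom.hom τ x) = Hom.hom (aug R 1) x := fun x => by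
    rw [translate_apply, map_mul, q_j, one_mul, P.q_apply P.freeSection_q]
  have hface : ∀ z : cotripleIter R 2,
      Hom.hom τ (Hom.hom (face R 1 0) z) = Hom.hom τ (Hom.hom (face R 1 1) z) := fun z => by
    have h1 : D.toFun (Hom.hom (face R 1 0) z) =
        (P.cocycle).toFun z * D.toFun (Hom.hom (face R 1 1) z) := by
      rw [← hD, coboundary, AddMonoidHom.finsetSum_apply, Fin.sum_univ_two]
      simp only [AddMonoidHom.coe_smul, Pi.smul_apply]
      have : ∀ a b : Der S (aug R 2), a = ((-1 : ℤ) ^ ((0 : Fin 2) : ℕ) • a +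
          (-1 : ℤ) ^ ((1 : Fin 2) : ℕ) • b) + b := fun a b => by simp
      exact congrArg (fun d : Der S (aug R 2) => d.toFun z) (this
        (Der.precomp (face R 1 0) (face_aug R 1 0) D)
        (Der.precomp (face R 1 1) (face_aug R 1 1) D))
    have h2 : ∀ x, Hom.hom τ x = (Hom.hom P.j (D.toFun x))⁻¹ * Hom.hom P.freeSection x := fun x =>
      congrArg (· * _) (map_inv (Hom.hom P.j) (D.toFun x))
    have h3 : Hom.hom P.j (P.cocycle.toFun z) =
        Hom.hom P.freeSection (Hom.hom (face R 1 0) z) *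
          (Hom.hom P.freeSection (Hom.hom (face R 1 1) z))⁻¹ := P.j_diff _ _ z
    rw [h2, h2, h1, map_mul, h3]
    group
  -- The two faces of `gen 1 x` are `x` and the generator on its augmentation, so `τ x` depends only
  -- on the augmentation of `x`.
  have hτ : ∀ x, Hom.hom τ (gen 0 (Hom.hom (aug R 1) x)) = Hom.hom τ x := fun x => by
    rw [← face_one_gen, ← hface, face_zero_gen]
  have hτ' : ∀ x r, Hom.hom (aug R 1) x = r → Hom.hom τ (gen 0 r) = Hom.hom τ x := by
    rintro x _ rfl
    exact hτ x
  -- `gen` is not multiplicative, but `gen r * gen r'` and `gen (r * r')` have the same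
  -- augmentation, hence the same image under `τ`.
  let σ : R →* P.E := MonoidHom.mk' (fun r : R => Hom.hom τ (gen (R := R) 0 r)) fun r r' => by
    rw [hτ' (gen 0 r * gen 0 r') (r * r') (by rw [map_mul, aug_one_gen, aug_one_gen]), map_mul]
  refine ⟨⟨σ, fun r => ?_, fun r => ?_⟩, ?_⟩
  · refine (hτ' ((cotripleIter R 1).d₀ (gen 0 r)) _ ?_).trans (Hom.map_d₀ τ _)
    rw [Hom.map_d₀, aug_one_gen]
  · refine (hτ' ((cotripleIter R 1).d₁ (gen 0 r)) _ ?_).trans (Hom.map_d₁ τ _)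
    rw [Hom.map_d₁, aug_one_gen]
  · refine hom_ext (MonoidHom.ext fun r => ?_)
    exact (hτq _).trans (aug_one_gen r)

theorem exists_splitting_of_isZero (h : Limits.IsZero (cotripleCohomology S 1)) :
    ∃ σ : R ⟶ P.E, σ ≫ P.q = 𝟙 R := by
  have hex := (HomologicalComplex.exactAt_iff_isZero_homology (cotripleComplex S) 1).2 h
  have hd : ∀ n, (cotripleComplex S).d n (n + 1) = AddCommGrpCat.ofHom (coboundary S n) := fun n =>
    CochainComplex.of_d (fun n => AddCommGrpCat.of (Der S (aug R (n + 1))))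
      (fun n => AddCommGrpCat.ofHom (coboundary S n)) n
  rw [HomologicalComplex.exactAt_iff' _ 0 1 2 (by simp) (by simp), ShortComplex.ab_exact_iff] at hex
  obtain ⟨D, hD⟩ := hex P.cocycle ((congrArg (fun φ => φ P.cocycle) (hd 1)).trans
    P.coboundary_cocycle)
  exact P.exists_splitting D ((congrArg (fun φ => φ D) (hd 0)).symm.trans hD)

end SingularExt

end Cat1Group

/-! ### Heisenberg extensions -/

/-- The central extension of `T` by `D` with bilinear cocycle `β`. -/
@[ext]
structure HeisenbergGroup {T D : Type u} [CommGroup T] [CommGroup D] (β : T →* T →* D) :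
    Type u where
  center : D
  base : T

namespace HeisenbergGroup

variable {T D : Type u} [CommGroup T] [CommGroup D] (β : T →* T →* D)

instance : Mul (HeisenbergGroup β) :=
  ⟨fun x y => ⟨x.center * y.center * β x.base y.base, x.base * y.base⟩⟩

instance : One (HeisenbergGroup β) := ⟨⟨1, 1⟩⟩

/-- The factor `β(t, t)` cancels the cocycle value `β(t⁻¹, t)`. -/
instance : Inv (HeisenbergGroup β) := ⟨fun x => ⟨x.center⁻¹ * β x.base x.base, x.base⁻¹⟩⟩

@[simp] theorem mul_center (x y : HeisenbergGroup β) :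
    (x * y).center = x.center * y.center * β x.base y.base := rfl

@[simp] theorem mul_base (x y : HeisenbergGroup β) : (x * y).base = x.base * y.base := rfl

@[simp] theorem one_center : (1 : HeisenbergGroup β).center = 1 := rfl

@[simp] theorem one_base : (1 : HeisenbergGroup β).base = 1 := rfl

@[simp] theorem inv_center (x : HeisenbergGroup β) :
    (x⁻¹).center = x.center⁻¹ * β x.base x.base := rfl

@[simp] theorem inv_base (x : HeisenbergGroup β) : (x⁻¹).base = x.base⁻¹ := rfl

instance : Group (HeisenbergGroup β) :=
  Group.ofLeftAxioms
    (fun x y z => HeisenbergGroup.ext (by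
      simp only [mul_center, mul_base, map_mul, MonoidHom.mul_apply]
      generalize β x.base y.base = a
      generalize β x.base z.base = b
      generalize β y.base z.base = c
      ac_rfl) (mul_assoc _ _ _))
    (fun x => by ext <;> simp)
    (fun x => by ext <;> simp)

/-- The action of `Hom(T, D)` on the central extension of `T` by `D`. -/
def act : (T →* D) →* MulAut (HeisenbergGroup β) where
  toFun φ :=
    { toFun := fun x => ⟨x.center * φ x.base, x.base⟩
      invFun := fun x => ⟨x.center * (φ x.base)⁻¹, x.base⟩
      left_inv := fun x => by ext <;> simp
      right_inv := fun x => by ext <;> simp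
      map_mul' := fun x y => HeisenbergGroup.ext (by simp; ac_rfl) rfl }
  map_one' := by ext <;> simp
  map_mul' φ ψ := by
    ext x
    · change x.center * (φ x.base * ψ x.base) = x.center * ψ x.base * φ x.base
      ac_rfl
    · rfl

/-- The crossed module given by the commutator pairing of a central extension. -/
def crossedModule : CrossedModule.{u} where
  T := HeisenbergGroup β
  G := T →* D
  -- Lifts of `t` and `t'` have commutator `β(t, t') / β(t', t)` in the center, so acting through
  -- this `μ` is conjugation.
  μ := MonoidHom.mk' (fun x => β x.base / β.flip x.base) fun x y => by
    simp only [mul_base, map_mul]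
    rw [mul_div_mul_comm]
  act := act β
  μ_act φ x := by
    rw [mul_comm φ, mul_inv_cancel_right]
    rfl
  peiffer x y := by
    rw [eq_mul_inv_iff_mul_eq]
    ext
    · change y.center * (β x.base y.base / β y.base x.base) * x.center * β y.base x.base =
        x.center * y.center * β x.base y.base
      rw [mul_right_comm _ x.center, mul_assoc y.center, div_mul_cancel]
      ac_rfl
    · exact mul_comm _ _

end HeisenbergGroup

/-! ### Heisenberg extensions as singular extensions of `T → 1` -/

namespace CrossedModule

variable (T D : Type u) [CommGroup T] [CommGroup D]

/-- The crossed module `T → 1` of an abelian group. -/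
def ofCommGroup : CrossedModule.{u} where
  T := T
  G := PUnit.{u + 1}
  μ := 1
  act := 1
  μ_act _ _ := rfl
  peiffer t t' := by
    change t' = t * t' * t⁻¹
    rw [mul_comm t, mul_inv_cancel_right]

/-- The crossed module `1 : D → Hom(T, D)`. -/
def dualCoeff : CrossedModule.{u} where
  T := D
  G := T →* D
  μ := 1
  act := 1
  μ_act φ _ := by
    change 1 = φ * 1 * φ⁻¹
    rw [mul_one, mul_inv_cancel]
  peiffer t t' := by
    change t' = t * t' * t⁻¹
    rw [mul_comm t, mul_inv_cancel_right]

variable {T D}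
variable (β : T →* T →* D)

/-- The inclusion of the coefficients in a Heisenberg extension. -/
def heisenbergIncl : dualCoeff T D ⟶ HeisenbergGroup.crossedModule β where
  f := MonoidHom.mk' (fun d : D => (⟨d, 1⟩ : HeisenbergGroup β)) fun d d' : D =>
    HeisenbergGroup.ext (by change d * d' = d * d' * β 1 1; simp) (one_mul (1 : T)).symm
  h := MonoidHom.id (T →* D)
  comm d := by
    change β 1 / β.flip 1 = 1
    rw [map_one, map_one, div_one]
  equivariant (φ : T →* D) (d : D) := HeisenbergGroup.ext
    (by change d = d * φ 1; rw [map_one, mul_one]) rfl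

/-- The projection of a Heisenberg extension. -/
def heisenbergProj : HeisenbergGroup.crossedModule β ⟶ ofCommGroup T where
  f := MonoidHom.mk' (fun x : HeisenbergGroup β => x.base) fun _ _ => rfl
  h := 1
  comm _ := rfl
  equivariant _ _ := rfl

variable (T D) in
/-- The section of the split Heisenberg extension. -/
def heisenbergSection : ofCommGroup T ⟶ HeisenbergGroup.crossedModule (1 : T →* T →* D) where
  f := MonoidHom.mk' (fun t : T => (⟨1, t⟩ : HeisenbergGroup (1 : T →* T →* D))) fun _ _ : T =>
    HeisenbergGroup.ext (by change (1 : D) = 1 * 1 * 1; simp) rfl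
  h := 1
  comm t := MonoidHom.ext fun t' => div_one (1 : D)
  equivariant _ t := HeisenbergGroup.ext (by change (1 : D) = 1 * 1; rw [mul_one]) rfl

theorem heisenbergIncl_injective :
    Function.Injective (Cat1Group.Hom.hom (toCat1Group.map (heisenbergIncl β))) := by
  intro x y h
  refine SemidirectProduct.ext ?_ ?_
  · exact congrArg (fun z : HeisenbergGroup β ⋊[HeisenbergGroup.act β] (T →* D) => z.left.center) h
  · exact congrArg (fun z : HeisenbergGroup β ⋊[HeisenbergGroup.act β] (T →* D) => z.right) h

theorem heisenbergProj_surjective :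
    Function.Surjective (Cat1Group.Hom.hom (toCat1Group.map (heisenbergProj β))) := fun x =>
  ⟨(⟨⟨1, x.left⟩, 1⟩ : HeisenbergGroup β ⋊[HeisenbergGroup.act β] (T →* D)), rfl⟩

theorem heisenberg_exact :
    (Cat1Group.Hom.hom (toCat1Group.map (heisenbergIncl β))).range =
      (Cat1Group.Hom.hom (toCat1Group.map (heisenbergProj β))).ker := by
  ext x
  constructor
  · rintro ⟨a, rfl⟩
    rfl
  · intro hx
    refine ⟨(⟨x.left.center, x.right⟩ : D ⋊[(dualCoeff T D).act] (T →* D)), ?_⟩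
    refine SemidirectProduct.ext (HeisenbergGroup.ext rfl ?_) rfl
    exact (congrArg SemidirectProduct.left (MonoidHom.mem_ker.1 hx)).symm

variable (T D) in
/-- The crossed module `D → Hom(T, D)` as a module over `T → 1`. -/
def dualMod : Mod (ofCommGroup T) where
  obj := dualCoeff T D
  str :=
    { singular := fun a b => SemidirectProduct.ext (mul_comm (G := D) _ _)
        (mul_comm (G := T →* D) _ _)
      E := toCat1Group.obj (HeisenbergGroup.crossedModule (1 : T →* T →* D))
      i := toCat1Group.map (heisenbergIncl 1)
      p := toCat1Group.map (heisenbergProj 1)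
      s := toCat1Group.map (heisenbergSection T D)
      s_p := by
        rw [← Functor.map_comp]
        exact toCat1Group.map_id (ofCommGroup T)
      injective := heisenbergIncl_injective 1
      exact := heisenberg_exact 1 }

/-- The elements of the cat¹-group of `T → 1`. -/
def ofCommGroupElt (t : T) : toCat1Group.obj (ofCommGroup T) :=
  (⟨t, PUnit.unit⟩ : (ofCommGroup T).T ⋊[(ofCommGroup T).act] (ofCommGroup T).G)

/-- The elements of the cat¹-group of `D → Hom(T, D)`. -/
def dualCoeffElt (d : D) (φ : T →* D) : toCat1Group.obj (dualCoeff T D) :=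
  (⟨d, φ⟩ : (dualCoeff T D).T ⋊[(dualCoeff T D).act] (dualCoeff T D).G)

/-- The elements of the cat¹-group of a Heisenberg extension. -/
def heisenbergElt (d : D) (t : T) (φ : T →* D) :
    toCat1Group.obj (HeisenbergGroup.crossedModule β) :=
  (⟨⟨d, t⟩, φ⟩ : (HeisenbergGroup.crossedModule β).T ⋊[(HeisenbergGroup.crossedModule β).act]
    (HeisenbergGroup.crossedModule β).G)

theorem heisenbergElt_mul (d d' : D) (t t' : T) (φ φ' : T →* D) :
    heisenbergElt β d t φ * heisenbergElt β d' t' φ' =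
      heisenbergElt β (d * (d' * φ t') * β t t') (t * t') (φ * φ') := rfl

theorem dualMod_act (t : T) (d : D) (φ : T →* D) :
    (dualMod T D).str.act (ofCommGroupElt t) (dualCoeffElt d φ) =
      dualCoeffElt (d * (φ t)⁻¹) φ := by
  have key : heisenbergElt 1 1 t 1 * heisenbergElt 1 d 1 φ =
      heisenbergElt 1 (d * (φ t)⁻¹) 1 φ * heisenbergElt 1 1 t 1 := by
    rw [heisenbergElt_mul, heisenbergElt_mul]
    simp
  exact Cat1Group.ModuleStr.act_eq _ key

/-- The Heisenberg extension of a bilinear map as a singular extension of cat¹-groups. -/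
def heisenbergExt : Cat1Group.SingularExt (dualMod T D).str where
  E := toCat1Group.obj (HeisenbergGroup.crossedModule β)
  j := toCat1Group.map (heisenbergIncl β)
  q := toCat1Group.map (heisenbergProj β)
  injective := heisenbergIncl_injective β
  surjective := heisenbergProj_surjective β
  exact := heisenberg_exact β
  j_act e a := by
    obtain ⟨⟨d', t⟩, (χ : T →* D)⟩ := e
    obtain ⟨(d : D), (φ : T →* D)⟩ := a
    -- The cocycle enters only as `β(1, t)` and `β(t, 1)`, which are trivial. So every `β` induces
    -- the same action on the kernel as the split extension, and `dualMod` serves for all of them.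
    have key : heisenbergElt β (d * (φ t)⁻¹) 1 φ * heisenbergElt β d' t χ =
        heisenbergElt β d' t χ * heisenbergElt β d 1 φ := by
      rw [heisenbergElt_mul, heisenbergElt_mul]
      simp [mul_comm φ, mul_comm d, mul_assoc, mul_left_comm]
    refine eq_mul_inv_iff_mul_eq.2 (Eq.trans ?_ key)
    exact congrArg (fun b => Cat1Group.Hom.hom (toCat1Group.map (heisenbergIncl β)) b *
      heisenbergElt β d' t χ) (dualMod_act t d φ)

/-- A Heisenberg extension whose pairing is not symmetric does not split. -/
theorem heisenbergExt_not_split {t t' : T} (h : β t t' ≠ β t' t)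
    (σ : toCat1Group.obj (ofCommGroup T) ⟶ (heisenbergExt β).E)
    (hσ : σ ≫ (heisenbergExt β).q = 𝟙 _) : False := by
  -- Both `d₀` and `d₁` kill `t`, so they kill `σ t`. The first makes its component in `Hom(T, D)`
  -- trivial, the second then makes `β(t, ·) / β(·, t)` trivial.
  have h0 := Cat1Group.Hom.map_d₀ σ (ofCommGroupElt t)
  have h1 := Cat1Group.Hom.map_d₁ σ (ofCommGroupElt t)
  have h2 := (heisenbergExt β).q_apply hσ (ofCommGroupElt t)
  have e0 : (toCat1Group.obj (ofCommGroup T)).d₀ (ofCommGroupElt t) = 1 := rfl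
  have e1 : (toCat1Group.obj (ofCommGroup T)).d₁ (ofCommGroupElt t) = 1 := rfl
  rw [e0, map_one] at h0
  rw [e1, map_one] at h1
  revert h0 h1 h2
  generalize Cat1Group.Hom.hom σ (ofCommGroupElt t) = x
  obtain ⟨⟨d, s⟩, (φ : T →* D)⟩ := x
  intro h0 h1 h2
  have hφ : 1 = φ := congrArg SemidirectProduct.right h0
  have hμ : (1 : T →* D) = β s / β.flip s * φ := congrArg SemidirectProduct.right h1
  have hs : s = t := congrArg SemidirectProduct.left h2
  subst hs hφ
  rw [mul_one] at hμ
  exact h (div_eq_one.1 (DFunLike.congr_fun hμ t').symm)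

end CrossedModule

/-! ### Injectivity of the coefficients -/

/-- Homomorphisms to a divisible group extend along injective homomorphisms of abelian groups. -/
theorem MonoidHom.exists_comp_eq_of_divisible {A B D : Type u} [Group A] [Group B] [AddCommGroup D]
    [DivisibleBy D ℤ] (hA : ∀ a a' : A, a * a' = a' * a) (hB : ∀ b b' : B, b * b' = b' * b)
    (f : A →* B) (hf : Function.Injective f) (g : A →* Multiplicative D) :
    ∃ h : B →* Multiplicative D, h.comp f = g := by
  let : CommGroup A := { ‹Group A› with mul_comm := hA }
  let : CommGroup B := { ‹Group B› with mul_comm := hB }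
  have := AddCommGrpCat.injective_of_divisible D
  let f' : AddCommGrpCat.of (Additive A) ⟶ AddCommGrpCat.of (Additive B) :=
    AddCommGrpCat.ofHom (MonoidHom.toAdditive f)
  have : Mono f' := (AddCommGrpCat.mono_iff_injective f').2 hf
  let g' : AddCommGrpCat.of (Additive A) ⟶ AddCommGrpCat.of D :=
    AddCommGrpCat.ofHom (MonoidHom.toAdditiveLeft g)
  refine ⟨AddMonoidHom.toMultiplicativeRight (Injective.factorThru g' f').hom, ?_⟩
  ext a
  exact congrArg (fun φ => φ (Additive.ofMul a)) (Injective.comp_factorThru g' f')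

namespace CrossedModule

open Cat1Group

/-! ### Modules over `T → 1` as bilinear pairings -/

section Singular

variable {T : Type u} [CommGroup T] (A : Mod (ofCommGroup T))

/-- The element `(a, b)` of the cat¹-group of a crossed module. -/
def elt (X : CrossedModule.{u}) (a : X.T) (b : X.G) : toCat1Group.obj X :=
  (⟨a, b⟩ : X.T ⋊[X.act] X.G)

theorem elt_mul (X : CrossedModule.{u}) (a a' : X.T) (b b' : X.G) :
    elt X a b * elt X a' b' = elt X (a * X.act b a') (b * b') := rfl

theorem elt_inj {X : CrossedModule.{u}} {a a' : X.T} {b b' : X.G} (h : elt X a b = elt X a' b') :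
    a = a' ∧ b = b' :=
  ⟨congrArg SemidirectProduct.left h, congrArg SemidirectProduct.right h⟩

theorem Mod.mul_comm_T {X : CrossedModule.{u}} (A : Mod X) (a a' : A.obj.T) : a * a' = a' * a := by
  have h := A.str.singular (elt _ a 1) (elt _ a' 1)
  rw [elt_mul, elt_mul] at h
  simpa using (elt_inj h).1

theorem Mod.act_eq_self {X : CrossedModule.{u}} (A : Mod X) (b : A.obj.G) (a : A.obj.T) :
    A.obj.act b a = a := by
  have h := A.str.singular (elt _ 1 b) (elt _ a 1)
  rw [elt_mul, elt_mul] at h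
  simpa using (elt_inj h).1

/-- The pairing of `t ∈ T` and `b` given by the action on a module over `T → 1`. -/
noncomputable def pairing (t : T) (b : A.obj.G) : A.obj.T :=
  SemidirectProduct.left (φ := A.obj.act) (A.str.act (ofCommGroupElt t) (elt _ 1 b))

theorem act_inl (t : T) (a : A.obj.T) :
    A.str.act (ofCommGroupElt t) (elt _ a 1) = elt _ a 1 :=
  A.str.act_of_d₁_eq_one rfl rfl

/-- Since `d₀` kills `t`, the action of `t` does not change `d₀` of an element, that is, its
component in `G`. -/
theorem act_inr (t : T) (b : A.obj.G) :
    A.str.act (ofCommGroupElt t) (elt _ 1 b) = elt _ (pairing A t b) b := by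
  have h := A.str.d₀_act (ofCommGroupElt t) (elt _ 1 b)
  have e : (toCat1Group.obj (ofCommGroup T)).d₀ (ofCommGroupElt t) = 1 := rfl
  rw [e, ModuleStr.one_act] at h
  have h' := congrArg (fun z : A.obj.T ⋊[A.obj.act] A.obj.G => z.right) h
  exact SemidirectProduct.ext rfl h'

theorem elt_eq (X : CrossedModule.{u}) (a : X.T) (b : X.G) :
    elt X a b = elt X a 1 * elt X 1 b := by
  rw [elt_mul]; simp

theorem act_elt (t : T) (a : A.obj.T) (b : A.obj.G) :
    A.str.act (ofCommGroupElt t) (elt _ a b) = elt _ (a * pairing A t b) b := by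
  rw [elt_eq, ModuleStr.act_mul, act_inl, act_inr, elt_mul]
  simp

theorem pairing_mul_left (t t' : T) (b : A.obj.G) :
    pairing A (t * t') b = pairing A t b * pairing A t' b := by
  have h := A.str.mul_act (ofCommGroupElt t) (ofCommGroupElt t') (elt _ 1 b)
  have e : ofCommGroupElt t * ofCommGroupElt t' = ofCommGroupElt (t * t') := rfl
  rw [e, act_inr, act_inr, act_elt] at h
  rw [(elt_inj h).1, A.mul_comm_T]

theorem pairing_mul_right (t : T) (b b' : A.obj.G) :
    pairing A t (b * b') = pairing A t b * pairing A t b' := by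
  have h := A.str.act_mul (ofCommGroupElt t) (elt _ 1 b) (elt _ 1 b')
  rw [elt_mul, map_one, mul_one, act_inr, act_inr, act_inr, elt_mul, A.act_eq_self] at h
  exact (elt_inj h).1

/-- The element `(a⁻¹, μ a)` lies in `ker d₁` and `t` in `ker d₀`, so `t` fixes it. -/
theorem pairing_μ (t : T) (a : A.obj.T) : pairing A t (A.obj.μ a) = 1 := by
  have h1 : A.str.act (ofCommGroupElt t) (elt _ a⁻¹ (A.obj.μ a)) = elt _ a⁻¹ (A.obj.μ a) := by
    refine A.str.act_of_d₀_eq_one rfl (SemidirectProduct.ext rfl ?_)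
    change A.obj.μ a⁻¹ * A.obj.μ a = 1
    rw [map_inv, inv_mul_cancel]
  rw [act_elt] at h1
  exact mul_eq_left.1 (elt_inj h1).1

/-- A morphism of crossed modules is a morphism of modules over `T → 1` if and only if it is
compatible with the pairings. -/
theorem isModuleHom_iff_pairing {A B : Mod (ofCommGroup T)} (f : A.obj ⟶ B.obj) :
    IsModuleHom A.str B.str (toCat1Group.map f) ↔
      ∀ t b, Hom.f f (pairing A t b) = pairing B t (Hom.h f b) := by
  rw [isModuleHom_iff]
  have key : ∀ a b, Cat1Group.Hom.hom (toCat1Group.map f) (elt _ a b) =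
      elt _ (Hom.f f a) (Hom.h f b) := fun a b => rfl
  constructor
  · intro h t b
    have := h (ofCommGroupElt t) (elt _ 1 b)
    rw [act_inr, key, key, act_elt, map_one, one_mul] at this
    exact (elt_inj this).1
  · rintro h ⟨(t : T), x⟩ ⟨a, b⟩
    change Cat1Group.Hom.hom (toCat1Group.map f) (A.str.act (ofCommGroupElt t) (elt _ a b)) =
      B.str.act (ofCommGroupElt t) (Cat1Group.Hom.hom (toCat1Group.map f) (elt _ a b))
    rw [act_elt, key, key, act_elt, map_mul, h]

end Singular

/-! ### The modules `K = K` with zero pairing -/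

section TrivialMod

variable (T K : Type u) [CommGroup T] [CommGroup K]

/-- The crossed module `K = K` of an abelian group. -/
def idCrossedModule : CrossedModule.{u} where
  T := K
  G := K
  μ := MonoidHom.id K
  act := 1
  μ_act g t := by
    change t = g * t * g⁻¹
    rw [mul_comm g, mul_inv_cancel_right]
  peiffer t t' := by
    change t' = t * t' * t⁻¹
    rw [mul_comm t, mul_inv_cancel_right]

/-- The product of the crossed modules `K = K` and `T → 1`. -/
def idProd : CrossedModule.{u} where
  T := K × T
  G := K
  μ := MonoidHom.fst K T
  act := 1
  μ_act g t := by
    change t.1 = g * t.1 * g⁻¹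
    rw [mul_comm g, mul_inv_cancel_right]
  peiffer t t' := by
    change t' = t * t' * t⁻¹
    rw [mul_comm t, mul_inv_cancel_right]

/-- The inclusion of the first factor. -/
def idProdIncl : idCrossedModule K ⟶ idProd T K where
  f := MonoidHom.inl K T
  h := MonoidHom.id K
  comm _ := rfl
  equivariant _ _ := rfl

/-- The projection to the second factor. -/
def idProdProj : idProd T K ⟶ ofCommGroup T where
  f := MonoidHom.snd K T
  h := 1
  comm _ := rfl
  equivariant _ _ := rfl

/-- The inclusion of the second factor. -/
def idProdSection : ofCommGroup T ⟶ idProd T K where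
  f := MonoidHom.inr K T
  h := 1
  comm _ := rfl
  equivariant _ _ := rfl

/-- The crossed module `K = K` as a trivial module over `T → 1`. -/
def idMod : Mod (ofCommGroup T) where
  obj := idCrossedModule K
  str :=
    { singular := fun a b => SemidirectProduct.ext (mul_comm (G := K) _ _)
        (mul_comm (G := K) _ _)
      E := toCat1Group.obj (idProd T K)
      i := toCat1Group.map (idProdIncl T K)
      p := toCat1Group.map (idProdProj T K)
      s := toCat1Group.map (idProdSection T K)
      s_p := by
        rw [← Functor.map_comp]
        exact toCat1Group.map_id (ofCommGroup T)
      injective := fun a b h => SemidirectProduct.ext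
        (congrArg (fun z : (idProd T K).T ⋊[(idProd T K).act] (idProd T K).G => z.left.1) h)
        (congrArg (fun z : (idProd T K).T ⋊[(idProd T K).act] (idProd T K).G => z.right) h)
      exact := by
        ext x
        constructor
        · rintro ⟨a, rfl⟩
          rfl
        · intro hx
          refine ⟨elt (idCrossedModule K) x.left.1 x.right, ?_⟩
          refine SemidirectProduct.ext (Prod.ext rfl ?_) rfl
          exact (congrArg SemidirectProduct.left (MonoidHom.mem_ker.1 hx)).symm }

theorem pairing_idMod (t : T) (b : (idMod T K).obj.G) : pairing (idMod T K) t b = 1 := by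
  have key : elt (idProd T K) (1, t) 1 * elt (idProd T K) 1 b =
      elt (idProd T K) 1 b * elt (idProd T K) (1, t) 1 :=
    SemidirectProduct.ext (mul_comm (G := K × T) _ _) (mul_comm (G := K) _ _)
  have h : (idMod T K).str.act (ofCommGroupElt t) (elt (idCrossedModule K) 1 b) =
      elt (idCrossedModule K) 1 b := ModuleStr.act_eq _ key
  exact (elt_inj ((act_inr (idMod T K) t b).symm.trans h)).1

end TrivialMod

/-! ### Injectivity of `D → Hom(T, D)` for divisible `D` -/

section Injective

variable {T : Type u} [CommGroup T]

/-- The morphism from `K = K` given by a homomorphism from `K` to the top group of a module. -/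
def idModLift {K : Type u} [CommGroup K] (A : Mod (ofCommGroup T)) (k : K →* A.obj.T) :
    idMod T K ⟶ A where
  hom :=
    { f := k
      h := A.obj.μ.comp k
      comm := fun _ => rfl
      equivariant := fun _ _ => (A.act_eq_self _ _).symm }
  isModuleHom := by
    rw [isModuleHom_iff_pairing]
    intro t b
    rw [pairing_idMod]
    exact (map_one k).trans (pairing_μ A t (k b)).symm

/-- Let `K` be the kernel of the top component. Its inclusion and the trivial map extend to
morphisms from `K = K` to `A` that agree after `f`, so they are equal and `K` is trivial. -/
theorem Mod.injective_f_of_mono {A B : Mod (ofCommGroup T)} (f : A ⟶ B) [Mono f] :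
    Function.Injective (Hom.f (Mod.Hom.hom f)) := by
  rw [injective_iff_map_eq_one]
  intro a ha
  let : CommGroup (Hom.f (Mod.Hom.hom f)).ker :=
    { mul_comm := fun a b => Subtype.ext (A.mul_comm_T _ _) }
  have h : idModLift A (Hom.f (Mod.Hom.hom f)).ker.subtype = idModLift A 1 := by
    rw [← cancel_mono f]
    refine Mod.Hom.ext (CrossedModule.Hom.ext (MonoidHom.ext fun x => ?_) (MonoidHom.ext fun x => ?_))
    · exact (MonoidHom.mem_ker.1 x.2).trans (map_one (Hom.f (Mod.Hom.hom f))).symm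
    · refine (Hom.comm (Mod.Hom.hom f) x.1).symm.trans ?_
      refine Eq.trans ?_ (Hom.comm (Mod.Hom.hom f) 1)
      rw [MonoidHom.mem_ker.1 x.2, map_one, map_one, map_one]
  exact congrArg (fun φ : idMod T (Hom.f (Mod.Hom.hom f)).ker ⟶ A =>
    Hom.f (Mod.Hom.hom φ) (⟨a, ha⟩ : (Hom.f (Mod.Hom.hom f)).ker)) h

theorem pairing_dualMod {D : Type u} [CommGroup D] (t : T) (φ : T →* D) :
    pairing (dualMod T D) t φ = ((φ t)⁻¹ : D) :=
  ((elt_inj ((act_inr (dualMod T D) t φ).symm.trans (dualMod_act t 1 φ))).1).trans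
    (one_mul ((φ t)⁻¹ : D))

/-- The morphism to `D → Hom(T, D)` given by a homomorphism from the top group of a module. -/
noncomputable def dualModLift {D : Type u} [CommGroup D] (B : Mod (ofCommGroup T))
    (k : B.obj.T →* D) : B ⟶ dualMod T D where
  hom :=
    { f := k
      h := MonoidHom.mk' (fun b => (MonoidHom.mk' (fun t => (k (pairing B t b))⁻¹) fun t t' => by
          rw [pairing_mul_left, map_mul, mul_inv] : T →* D)) fun b b' =>
            MonoidHom.ext fun t => by
              change (k (pairing B t (b * b')))⁻¹ = (k (pairing B t b))⁻¹ * (k (pairing B t b'))⁻¹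
              rw [pairing_mul_right, map_mul, mul_inv]
      comm := fun a => MonoidHom.ext fun t => by
        change 1 = (k (pairing B t (B.obj.μ a)))⁻¹
        rw [pairing_μ, map_one, inv_one]
      equivariant := fun b a => congrArg k (B.act_eq_self b a) }
  isModuleHom := by
    rw [isModuleHom_iff_pairing]
    intro t b
    refine Eq.trans ?_ (pairing_dualMod (D := D) t _).symm
    exact (inv_inv (G := D) (k (pairing B t b))).symm

/-- Compatibility with the pairings forces the bottom component to be `b ↦ (t ↦ k(pairing t b)⁻¹)`,
where `k` is the top component. With `dualModLift`, this gives the bijection between morphisms to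
`dualMod` and homomorphisms to `D`. -/
theorem dualMod_hom_ext {D : Type u} [CommGroup D] {B : Mod (ofCommGroup T)}
    {g g' : B ⟶ dualMod T D} (h : Hom.f (Mod.Hom.hom g) = Hom.f (Mod.Hom.hom g')) : g = g' := by
  refine Mod.Hom.ext (CrossedModule.Hom.ext h (MonoidHom.ext fun b => ?_))
  have key : ∀ (g : B ⟶ dualMod T D) (t : T),
      DFunLike.coe (F := T →* D) (Hom.h (Mod.Hom.hom g) b) t =
        Inv.inv (α := D) (Hom.f (Mod.Hom.hom g) (pairing B t b)) := fun g t => by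
    have h1 := (isModuleHom_iff_pairing (Mod.Hom.hom g)).1 (Mod.Hom.isModuleHom g) t b
    exact (inv_eq_iff_eq_inv (G := D)).1 (h1.trans (pairing_dualMod t _)).symm
  exact MonoidHom.ext fun t => (key g t).trans (by rw [h]; exact (key g' t).symm)

/-- Extending a morphism reduces to extending its top component, a homomorphism to a divisible
group, along an injection of abelian groups. -/
instance injective_dualMod {D : Type u} [AddCommGroup D] [DivisibleBy D ℤ] :
    Injective (dualMod T (Multiplicative D)) where
  factors {A B} g f _ := by
    obtain ⟨k, hk⟩ := MonoidHom.exists_comp_eq_of_divisible (D := D) A.mul_comm_T B.mul_comm_T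
      (Hom.f (Mod.Hom.hom f)) (Mod.injective_f_of_mono f) (Hom.f (Mod.Hom.hom g))
    exact ⟨dualModLift B k, dualMod_hom_ext hk⟩

end Injective

/-! ### The counterexample over `ℚ` -/

/-- The bilinear map `(a, b), (c, d) ↦ a d` on `ℚ²`. -/
def rationalPairing :
    Multiplicative (ULift.{u} (ℚ × ℚ)) →* Multiplicative (ULift.{u} (ℚ × ℚ)) →*
      Multiplicative (ULift.{u} ℚ) :=
  MonoidHom.mk' (fun x => MonoidHom.mk' (fun y => Multiplicative.ofAdd
    ⟨x.toAdd.down.1 * y.toAdd.down.2⟩) fun _ _ =>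
      congrArg Multiplicative.ofAdd (ULift.ext _ _ (mul_add x.toAdd.down.1 _ _)))
    fun _ _ => MonoidHom.ext fun y =>
      congrArg Multiplicative.ofAdd (ULift.ext _ _ (add_mul _ _ y.toAdd.down.2))

theorem not_isBalanced : ¬ IsBalanced.{u} := by
  intro h
  let : DivisibleBy (ULift.{u} ℚ) ℤ :=
    { div := fun a n => ⟨a.down / n⟩
      div_zero := fun a => ULift.ext _ _ (by simp)
      div_cancel := fun {n} a hn => ULift.ext _ _ (by
        have : (n : ℚ) ≠ 0 := Int.cast_ne_zero.2 hn
        simp [mul_div_cancel₀ _ this]) }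
  obtain ⟨σ, hσ⟩ := (heisenbergExt rationalPairing.{u}).exists_splitting_of_isZero
    (h (ofCommGroup _) (dualMod _ _) injective_dualMod 1 one_pos)
  refine heisenbergExt_not_split rationalPairing.{u} (t := Multiplicative.ofAdd ⟨(1, 0)⟩)
    (t' := Multiplicative.ofAdd ⟨(0, 1)⟩) (fun e => ?_) σ hσ
  -- On the standard basis, `β(e₁, e₂) = 1` and `β(e₂, e₁) = 0`.
  have e' : (1 : ℚ) * 1 = 0 * 0 := congrArg (fun z => z.toAdd.down) e
  norm_num at e'

end CrossedModule

/-- The category of crossed modules in groups, considered as a category of interest through its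
equivalence with the category of cat¹-groups, is not balanced. -/
theorem theorem2p5 :
    CrossedModule.toCat1Group.{u}.IsEquivalence ∧ ¬ CrossedModule.IsBalanced.{u} := by
  exact ⟨inferInstance, CrossedModule.not_isBalanced⟩
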